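/- Let $n\ge 1$ and let $\Omega\subset\mathbb{R}^n$ be a bounded and strictly convex domain with smooth boundary (i.e. $\Omega$ is nonempty, open, bounded and convex, $\partial\Omega$ is $C^\infty$ and contains no nondegenerate segment). For every $x^0\in\partial\Omega$, with unit inward normal vector $\nu^0$ of $\partial\Omega$ at $x^0$, there exists a constant $\delta_0>0$ depending only on $x^0$ and $\Omega$ such that the following holds. Let $s=s_0+s_1$ and $t=t_0+t_1$ with integers $s_0,t_0\ge 1$ and $s_1,t_1\in(0,1)$, let $p,q\ge 1$ be real, and let $u,v:\mathbb{R}^n\to\mathbb{R}$, positive in $\Omega$, satisfy $$u\in C^{2s_0+[2s_1],\{2s_1\}+\varepsilon}_{loc}(\Omega)\cap C^{2s_0}(\overline\Omega),\qquad v\in C^{2t_0+[2t_1],\{2t_1\}+\varepsilon}_{loc}(\Omega)\cap C^{2t_0}(\overline\Omega)$$ for some (arbitrarily small) $\varepsilon>0$, where $[\cdot]$ and $\{\cdot\}$ denote the integer and the fractional part, and $$ \begin{cases} (-\Delta)^s u(x)=v^p(x),&x\in\Omega,\\ (-\Delta)^t v(x)=u^q(x),&x\in\Omega,\\ u(x)=-\Delta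 u(x)=\cdots=(-\Delta)^{s_0}u(x)=0,&x\in\mathbb{R}^n\setminus\Omega,\\ v(x)=-\Delta v(x)=\cdots=(-\Delta)^{t_0}v(x)=0,&x\in\mathbb{R}^n\setminus\Omega. \end{cases} $$ Then $(-\Delta)^i u$ $(i=0,\dots,s_0)$ and $(-\Delta)^j v$ $(j=0,\dots,t_0)$ are strictly monotone increasing along the direction $\nu^0$ in the region $$\tilde\Sigma_{\delta_0}=\{x\in\overline\Omega\mid 0\le (x-x^0)\cdot\nu^0\le\delta_0\},$$ that is, each of these functions $f$ satisfies $f(x)<f(x+h\nu^0)$ whenever $h>0$ and $x,\,x+h\nu^0\in\tilde\Sigma_{\delta_0}$. Here the values of $(-\Delta)^i u$ on $\partial\Omega$ are those of its continuous extension from $\Omega$ to $\overline\Omega$ (likewise for $v$); $(-\Delta)^s u:=(-\Delta)^{s_1}\big((-\Delta)^{s_0}u\big)$ and likewise for $(-\Delta)^t v$; and for $0<\sigma<1$ and $w\in L^1_{loc}(\mathbb{R}^n)$ with $\int_{\mathbb{R}^n}\frac{|w(x)|}{1+|x|^{n+2\sigma}}\,dx<\infty$, $$(-\Delta)^\sigma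 w(x)=C_{n,\sigma}\lim_{\delta\to0^+}\int_{\mathbb{R}^n\setminus B_\delta(x)}\frac{w(x)-w(y)}{|x-y|^{n+2\sigma}}\,dy,\qquad C_{n,\sigma}=\frac{4^\sigma\,\sigma\,\Gamma(\frac n2+\sigma)}{\pi^{n/2}\,\Gamma(1-\sigma)}.$$ -/

import Mathlib

open Set Filter Topology MeasureTheory
open scoped ContDiff

noncomputable section

/-- The Euclidean space `ℝⁿ`. -/
abbrev En (n : ℕ) : Type := EuclideanSpace ℝ (Fin n)

/-- `ρ` is a smooth function that defines `Ω` near the boundary point `x`: near `x` it is `C^∞`,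
`Ω` is the set where it is positive, and its derivative at `x` does not vanish. -/
structure IsLocalDefiningFunction {n : ℕ} (Ω : Set (En n)) (x : En n) (ρ : En n → ℝ) : Prop where
  smooth : ∃ U ∈ 𝓝 x, ContDiffOn ℝ ∞ ρ U
  zero : ρ x = 0
  grad_ne_zero : gradient ρ x ≠ 0
  eventually_mem_iff : ∀ᶠ y in 𝓝 x, (y ∈ Ω ↔ 0 < ρ y)

/-- A bounded, strictly convex domain with smooth boundary. Strict convexity is a condition on the
closure: the boundary contains no segment (for an open set, `StrictConvex ℝ Ω` is just convexity). -/
structure IsSmoothStrictlyConvexDomain {n : ℕ} (Ω : Set (En n)) : Prop where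
  isOpen : IsOpen Ω
  nonempty : Ω.Nonempty
  isBounded : Bornology.IsBounded Ω
  convex : Convex ℝ Ω
  strictConvex_closure : StrictConvex ℝ (closure Ω)
  smooth_boundary : ∀ x ∈ frontier Ω, ∃ ρ : En n → ℝ, IsLocalDefiningFunction Ω x ρ

/-- `ν` is the unit inward normal of `∂Ω` at `x`: the normalized gradient of a local defining
function of `Ω` at `x`. -/
def IsInwardUnitNormal {n : ℕ} (Ω : Set (En n)) (x ν : En n) : Prop :=
  ∃ ρ : En n → ℝ, IsLocalDefiningFunction Ω x ρ ∧ ν = ‖gradient ρ x‖⁻¹ • gradient ρ x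

/-- The function `(-Δ)^i u` on `ℝⁿ` for `u` that is `C^{2i}` up to the boundary of `Ω` and smooth
outside `closure Ω`. In `Ω` and in the exterior of `Ω` it is the classical iterated Laplacian; at
points of `∂Ω` the derivatives are those of `u` on `closure Ω`, that is, the continuous extensions
of the derivatives in `Ω`. -/
def iterNegLaplacian {n : ℕ} (Ω : Set (En n)) (i : ℕ) (u : En n → ℝ) (x : En n) : ℝ :=
  open Classical in
  if x ∈ closure Ω then
    ((fun (f : En n → ℝ) (y : En n) =>
      -InnerProductSpace.laplacianWithin f (closure Ω) y)^[i] u) x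
  else
    ((fun (f : En n → ℝ) (y : En n) => -Laplacian.laplacian f y)^[i] u) x

/-- The class `C^{k,α}_loc(Ω)`. -/
def MemHolderLoc {n : ℕ} (k : ℕ) (α : ℝ) (Ω : Set (En n)) (u : En n → ℝ) : Prop :=
  ContDiffOn ℝ k u Ω ∧
    ∀ K ⊆ Ω, IsCompact K → ∃ C : ℝ, ∀ x ∈ K, ∀ y ∈ K,
      ‖iteratedFDeriv ℝ k u x - iteratedFDeriv ℝ k u y‖ ≤ C * ‖x - y‖ ^ α

/-- The class `𝓛_{2σ}` of locally integrable functions `w` with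
`∫ |w(x)| / (1 + |x|^{n+2σ}) dx < ∞`. -/
def MemTailSpace {n : ℕ} (σ : ℝ) (w : En n → ℝ) : Prop :=
  LocallyIntegrable w ∧ Integrable (fun x : En n => |w x| / (1 + ‖x‖ ^ ((n : ℝ) + 2 * σ)))

/-- The normalizing constant `C_{n,σ} = 4^σ σ Γ(n/2+σ) / (π^{n/2} Γ(1-σ))`. -/
def fracLaplacianConst (n : ℕ) (σ : ℝ) : ℝ :=
  (4 : ℝ) ^ σ * σ * Real.Gamma ((n : ℝ) / 2 + σ) /
    (Real.pi ^ ((n : ℝ) / 2) * Real.Gamma (1 - σ))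

/-- `(-Δ)^σ w(x)` is defined as a principal value and equals `L`. -/
def HasFracLaplacianAt {n : ℕ} (σ : ℝ) (w : En n → ℝ) (x : En n) (L : ℝ) : Prop :=
  MemTailSpace σ w ∧
    Tendsto
      (fun δ : ℝ => fracLaplacianConst n σ *
        ∫ y in (Metric.ball x δ)ᶜ, (w x - w y) / ‖x - y‖ ^ ((n : ℝ) + 2 * σ))
      (𝓝[>] 0) (𝓝 L)

/-- The regularity class `C^{2s₀+[2s₁],{2s₁}+ε}_loc(Ω) ∩ C^{2s₀}(closure Ω)` for some `ε > 0`. -/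
def IsAdmissible {n : ℕ} (Ω : Set (En n)) (s₀ : ℕ) (s₁ : ℝ) (u : En n → ℝ) : Prop :=
  (∃ ε > 0, MemHolderLoc (2 * s₀ + ⌊2 * s₁⌋₊) (Int.fract (2 * s₁) + ε) Ω u) ∧
    ContDiffOn ℝ ((2 * s₀ : ℕ) : WithTop ℕ∞) u (closure Ω)

/-- `(u, v)` is a pair of positive classical solutions of `(-Δ)^{s₀+s₁} u = v^p`,
`(-Δ)^{t₀+t₁} v = u^q` in `Ω` with Navier exterior conditions, where
`(-Δ)^{s₀+s₁} = (-Δ)^{s₁} ∘ (-Δ)^{s₀}`. -/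
structure IsPositiveSolution {n : ℕ} (Ω : Set (En n)) (s₀ t₀ : ℕ) (s₁ t₁ p q : ℝ)
    (u v : En n → ℝ) : Prop where
  admissible_u : IsAdmissible Ω s₀ s₁ u
  admissible_v : IsAdmissible Ω t₀ t₁ v
  pos_u : ∀ x ∈ Ω, 0 < u x
  pos_v : ∀ x ∈ Ω, 0 < v x
  eq_u : ∀ x ∈ Ω, HasFracLaplacianAt s₁ (iterNegLaplacian Ω s₀ u) x (v x ^ p)
  eq_v : ∀ x ∈ Ω, HasFracLaplacianAt t₁ (iterNegLaplacian Ω t₀ v) x (u x ^ q)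
  navier_u : ∀ i ≤ s₀, ∀ x ∉ Ω, iterNegLaplacian Ω i u x = 0
  navier_v : ∀ j ≤ t₀, ∀ x ∉ Ω, iterNegLaplacian Ω j v x = 0

/-- The boundary layer `{x ∈ closure Ω | 0 ≤ (x - x₀) · ν ≤ δ}`. -/
def boundaryLayer {n : ℕ} (Ω : Set (En n)) (x₀ ν : En n) (δ : ℝ) : Set (En n) :=
  {x ∈ closure Ω | 0 ≤ inner ℝ (x - x₀) ν ∧ inner ℝ (x - x₀) ν ≤ δ}

/-- `f` is strictly increasing on `S` in the direction `ν`. -/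
def StrictlyIncreasingAlong {n : ℕ} (ν : En n) (S : Set (En n)) (f : En n → ℝ) : Prop :=
  ∀ x ∈ S, ∀ h : ℝ, 0 < h → x + h • ν ∈ S → f x < f (x + h • ν)

end

/-! ### The Laplacian as a sum of second derivatives along lines -/

section LineDerivatives

variable {E : Type*} [NormedAddCommGroup E] [NormedSpace ℝ E]

/-! The method is moving planes. Put `w i = (-Δ)^i u` and `z j = (-Δ)^j v`, all vanishing off `Ω`.
Each family is a chain of Poisson problems, closed by a fractional equation whose right side is a
power of the first member of the other family. Call `⟪x - x₀, ν⟫` the height of `x`. Let `R` be the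
reflection in the plane of height `a`, and `U i = w i ∘ R - w i`. If `U i` is positive below the
plane for every `0 < a ≤ δ`, strict monotonicity follows, since `x` and `x + hν` are mirror images
in the plane halfway between them.

The number `δ` is purely geometric. By strict convexity the closure of `Ω` touches the tangent plane
only at `x₀`, so low caps shrink to `x₀` and their reflections stay in `Ω`
(`exists_cap_translate_mem`). No solution enters this choice.

The heights `a` for which all differences are nonnegative on the cap form a closed set. It exhausts
`[0, δ]` because of two facts.

Strong maximum principle (`IsNavierChain.reflection_sub_pos`): nonnegative differences are strictly
positive below the plane. For the last member this comes from the antisymmetric nonlocal estimate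
`fracLaplacian_antisymmetric_neg`; for the others, an interior zero of `U i` would be a minimum with
`Δ (U i) = -U (i + 1) < 0`.

Narrow region principle (`reflection_sub_ge_half`): negativity confined to a thin slab under the
plane is impossible. A bound `-M` for the last difference of one chain descends unchanged to its
first one, through a quadratic barrier in a slab of width at most one. The power changes it to `-C *
M`. The fractional equation of the other chain divides by a constant of order `l ^ (-2σ)`, where `l`
is the slab width, which is arranged to exceed `2 * C`. Hence `-M` becomes `-M / 2`, and going once
around the system forces the negative part to vanish.

Both nonlocal facts rest on `fracLaplacian_antisymmetric_le`, which folds the singular integral onto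
the half-space below the plane. -/

theorem ContDiffAt.eventually_deriv_line {f : E → ℝ} {x : E} (hf : ContDiffAt ℝ 2 f x) (e : E) :
    ∀ᶠ t : ℝ in 𝓝 0, deriv (fun t : ℝ => f (x + t • e)) t = fderiv ℝ f (x + t • e) e := by
  have hc : ContinuousAt (fun t : ℝ => x + t • e) 0 := by fun_prop
  have h0 : x + (0 : ℝ) • e = x := by simp
  have hev : ∀ᶠ y in 𝓝 (x + (0 : ℝ) • e), DifferentiableAt ℝ f y := by
    rw [h0]
    filter_upwards [hf.eventually (by simp)] with y hy
    exact hy.differentiableAt (by norm_num)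
  filter_upwards [hc.eventually hev] with t ht
  have hl : HasDerivAt (fun t : ℝ => x + t • e) e t := by
    simpa using ((hasDerivAt_id t).smul_const e).const_add x
  exact (ht.hasFDerivAt.comp_hasDerivAt t hl).deriv

theorem ContDiffAt.hasDerivAt_deriv_line {f : E → ℝ} {x : E} (hf : ContDiffAt ℝ 2 f x) (e : E) :
    HasDerivAt (deriv (fun t : ℝ => f (x + t • e))) (iteratedFDeriv ℝ 2 f x ![e, e]) 0 := by
  have hl : HasDerivAt (fun t : ℝ => x + t • e) e 0 := by
    simpa using ((hasDerivAt_id (0 : ℝ)).smul_const e).const_add x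
  have h1 : ContDiffAt ℝ 1 (fderiv ℝ f) (x + (0 : ℝ) • e) := by
    simpa using hf.fderiv_right (m := 1) (by norm_num)
  have h2 := (h1.differentiableAt (by norm_num)).hasFDerivAt.comp_hasDerivAt (0 : ℝ) hl
  have h3 := h2.clm_apply (hasDerivAt_const (0 : ℝ) e)
  rw [iteratedFDeriv_two_apply]
  refine HasDerivAt.congr_of_eventuallyEq ?_ (hf.eventually_deriv_line e)
  simpa using h3

/-- A negative second derivative would make the point a local maximum as well, so the function would
be locally constant and its second derivative zero. -/
theorem IsLocalMin.deriv_deriv_nonneg {g : ℝ → ℝ} {a : ℝ} (h : IsLocalMin g a)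
    (hc : ContinuousAt g a) : 0 ≤ deriv (deriv g) a := by
  by_contra! hneg
  have hmax := isLocalMax_of_deriv_deriv_neg hneg h.deriv_eq_zero hc
  have hconst : g =ᶠ[𝓝 a] fun _ => g a := by
    filter_upwards [h, hmax] with t h1 h2
    exact le_antisymm h2 h1
  have h1 : deriv g =ᶠ[𝓝 a] fun _ => 0 := by
    simpa using hconst.deriv
  have h2 := h1.deriv_eq
  simp at h2
  linarith

end LineDerivatives

section LaplacianLines

variable {E : Type*} [NormedAddCommGroup E] [InnerProductSpace ℝ E] [FiniteDimensional ℝ E]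

theorem ContDiffAt.laplacian_eq_sum_deriv_deriv {ι : Type*} [Fintype ι]
    (b : OrthonormalBasis ι ℝ E) {f : E → ℝ} {x : E} (hf : ContDiffAt ℝ 2 f x) :
    Laplacian.laplacian f x = ∑ i, deriv (deriv fun t : ℝ => f (x + t • b i)) 0 := by
  rw [InnerProductSpace.laplacian_eq_iteratedFDeriv_orthonormalBasis f b]
  exact Finset.sum_congr rfl fun i _ => ((hf.hasDerivAt_deriv_line (b i)).deriv).symm

theorem IsLocalMin.laplacian_nonneg {f : E → ℝ} {x : E} (h : IsLocalMin f x)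
    (hf : ContDiffAt ℝ 2 f x) : 0 ≤ Laplacian.laplacian f x := by
  rw [hf.laplacian_eq_sum_deriv_deriv (stdOrthonormalBasis ℝ E)]
  refine Finset.sum_nonneg fun i _ => ?_
  have hc : ContinuousAt (fun t : ℝ => x + t • stdOrthonormalBasis ℝ E i) 0 := by fun_prop
  have h0 : x + (0 : ℝ) • stdOrthonormalBasis ℝ E i = x := by simp
  refine IsLocalMin.deriv_deriv_nonneg ?_ ?_
  · have hev : ∀ᶠ y in 𝓝 (x + (0 : ℝ) • stdOrthonormalBasis ℝ E i), f x ≤ f y := by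
      rw [h0]; exact h
    have := hc.eventually hev
    simpa [IsLocalMin, IsMinFilter] using this
  · exact ContinuousAt.comp (f := fun t : ℝ => x + t • stdOrthonormalBasis ℝ E i)
      (by rw [h0]; exact hf.continuousAt) hc

theorem ContDiffAt.laplacian_comp_isometry_add {f : E → ℝ} (R : E ≃ₗᵢ[ℝ] E) (c : E) {x : E}
    (hf : ContDiffAt ℝ 2 f (R x + c)) :
    Laplacian.laplacian (fun y => f (R y + c)) x = Laplacian.laplacian f (R x + c) := by
  have hcomp : ContDiffAt ℝ 2 (fun y => f (R y + c)) x :=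
    ContDiffAt.comp x hf (R.contDiff.contDiffAt.add contDiffAt_const)
  rw [hcomp.laplacian_eq_sum_deriv_deriv (stdOrthonormalBasis ℝ E),
    hf.laplacian_eq_sum_deriv_deriv ((stdOrthonormalBasis ℝ E).map R)]
  refine Finset.sum_congr rfl fun i _ => ?_
  congr 2
  funext t
  simp only [map_add, map_smul, OrthonormalBasis.map_apply]
  congr 1
  abel

/-- This squared distance to a plane (for unit `ν`) is the barrier used later in thin slabs. -/
theorem laplacian_sq_inner_sub (ν : E) (a : ℝ) (x : E) :
    Laplacian.laplacian (fun y : E => (inner ℝ y ν - a) ^ 2) x = 2 * ‖ν‖ ^ 2 := by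
  have hf : ContDiffAt ℝ 2 (fun y : E => (inner ℝ y ν - a) ^ 2) x :=
    (((contDiff_id.inner ℝ contDiff_const).sub contDiff_const).pow 2).contDiffAt
  rw [hf.laplacian_eq_sum_deriv_deriv (stdOrthonormalBasis ℝ E),
    ← (stdOrthonormalBasis ℝ E).sum_sq_norm_inner_right ν, Finset.mul_sum]
  refine Finset.sum_congr rfl fun i _ => ?_
  set c : ℝ := inner ℝ (stdOrthonormalBasis ℝ E i) ν
  set A : ℝ := inner ℝ x ν - a
  have h1 : (fun t : ℝ => (inner ℝ (x + t • stdOrthonormalBasis ℝ E i) ν - a) ^ 2) =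
      fun t => (A + t * c) ^ 2 := by
    funext t
    rw [inner_add_left, real_inner_smul_left]
    simp only [A, c]
    ring
  have hlin : ∀ t : ℝ, HasDerivAt (fun t : ℝ => A + t * c) c t := fun t => by
    simpa using ((hasDerivAt_id t).mul_const c).const_add A
  have h2 : deriv (fun t : ℝ => (A + t * c) ^ 2) = fun t => 2 * (A + t * c) * c := by
    funext t
    simp
  have h3 : HasDerivAt (fun t : ℝ => 2 * (A + t * c) * c) (2 * c * c) 0 :=
    ((hlin 0).const_mul 2).mul_const c
  rw [h1, h2, h3.deriv, Real.norm_eq_abs, sq_abs]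
  ring

/-- The Laplacian within a set with unique derivatives inherits regularity up to the boundary. -/
theorem ContDiffOn.laplacianWithin {f : E → ℝ} {s : Set E} {m k : WithTop ℕ∞}
    (hf : ContDiffOn ℝ k f s) (hs : UniqueDiffOn ℝ s) (hmk : m + 2 ≤ k) :
    ContDiffOn ℝ m (InnerProductSpace.laplacianWithin f s) s := by
  have h2 : ContDiffOn ℝ m (fderivWithin ℝ (fderivWithin ℝ f s) s) s :=
    (hf.fderivWithin hs (m := m + 1) (by rw [add_assoc]; exact_mod_cast hmk)).fderivWithin hs le_rfl
  have h3 : ContDiffOn ℝ m (fun x => ∑ i, fderivWithin ℝ (fderivWithin ℝ f s) s x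
      (stdOrthonormalBasis ℝ E i) (stdOrthonormalBasis ℝ E i)) s :=
    ContDiffOn.sum fun i _ => (h2.clm_apply contDiffOn_const).clm_apply contDiffOn_const
  refine h3.congr fun x hx => ?_
  rw [InnerProductSpace.laplacianWithin_eq_iteratedFDerivWithin_stdOrthonormalBasis f hs hx]
  refine Finset.sum_congr rfl fun i _ => ?_
  rw [iteratedFDerivWithin_two_apply f hs hx]
  simp

theorem laplacianWithin_eq_laplacian_of_mem_interior {f : E → ℝ} {s : Set E} {x : E}
    (hs : UniqueDiffOn ℝ s) (hx : x ∈ interior s) :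
    InnerProductSpace.laplacianWithin f s x = Laplacian.laplacian f x := by
  rw [InnerProductSpace.laplacianWithin_eq_iteratedFDerivWithin_stdOrthonormalBasis f hs
    (interior_subset hx), InnerProductSpace.laplacian_eq_iteratedFDeriv_stdOrthonormalBasis,
    ← iteratedFDerivWithin_univ, iteratedFDerivWithin_congr_set
      (Filter.eventuallyEq_univ.mpr (mem_interior_iff_mem_nhds.mp hx))]

end LaplacianLines

/-! ### Reflection in a hyperplane -/

section HyperplaneReflection

variable {E : Type*} [NormedAddCommGroup E] [InnerProductSpace ℝ E]

/-- Reflection in the hyperplane `{x | ⟪x - x₀, ν⟫ = a}`, for a unit vector `ν`. -/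
def hyperplaneReflection (x₀ ν : E) (a : ℝ) (x : E) : E :=
  x + (2 * (a - inner ℝ (x - x₀) ν)) • ν

variable {x₀ ν : E}

theorem continuous_hyperplaneReflection_uncurry :
    Continuous fun z : ℝ × E => hyperplaneReflection x₀ ν z.1 z.2 := by
  unfold hyperplaneReflection
  fun_prop

theorem continuous_hyperplaneReflection (a : ℝ) : Continuous (hyperplaneReflection x₀ ν a) := by
  unfold hyperplaneReflection
  fun_prop

theorem inner_hyperplaneReflection_sub (hν : ‖ν‖ = 1) (a : ℝ) (x : E) :
    inner ℝ (hyperplaneReflection x₀ ν a x - x₀) ν = 2 * a - inner ℝ (x - x₀) ν := by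
  have h : hyperplaneReflection x₀ ν a x - x₀ = (x - x₀) + (2 * (a - inner ℝ (x - x₀) ν)) • ν := by
    unfold hyperplaneReflection
    abel
  rw [h, inner_add_left, real_inner_smul_left, real_inner_self_eq_norm_sq, hν]
  ring

theorem hyperplaneReflection_hyperplaneReflection (hν : ‖ν‖ = 1) (a : ℝ) (x : E) :
    hyperplaneReflection x₀ ν a (hyperplaneReflection x₀ ν a x) = x := by
  have h : hyperplaneReflection x₀ ν a (hyperplaneReflection x₀ ν a x) =
    hyperplaneReflection x₀ ν a x +
      (2 * (a - inner ℝ (hyperplaneReflection x₀ ν a x - x₀) ν)) • ν := rfl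
  rw [h, inner_hyperplaneReflection_sub hν, hyperplaneReflection, add_assoc, ← add_smul]
  have : 2 * (a - inner ℝ (x - x₀) ν) + 2 * (a - (2 * a - inner ℝ (x - x₀) ν)) = 0 := by ring
  rw [this, zero_smul, add_zero]

theorem hyperplaneReflection_of_inner_eq {a : ℝ} {x : E} (h : inner ℝ (x - x₀) ν = a) :
    hyperplaneReflection x₀ ν a x = x := by
  simp [hyperplaneReflection, h]

/-- Writing the map as a linear reflection followed by a translation yields at once that it is an
isometry, preserves volume and commutes with the Laplacian. -/
theorem hyperplaneReflection_eq_reflection_add (hν : ‖ν‖ = 1) (a : ℝ) (x : E) :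
    hyperplaneReflection x₀ ν a x =
      (Submodule.span ℝ {ν})ᗮ.reflection x + (2 * (a + inner ℝ x₀ ν)) • ν := by
  rw [Submodule.reflection_orthogonal_apply, Submodule.reflection_singleton_apply, hν,
    hyperplaneReflection, inner_sub_left, real_inner_comm x ν]
  simp only [RCLike.ofReal_one, one_pow, div_one]
  module

theorem norm_hyperplaneReflection_sub (hν : ‖ν‖ = 1) (a : ℝ) (x y : E) :
    ‖hyperplaneReflection x₀ ν a x - hyperplaneReflection x₀ ν a y‖ = ‖x - y‖ := by
  rw [hyperplaneReflection_eq_reflection_add hν, hyperplaneReflection_eq_reflection_add hν,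
    add_sub_add_right_eq_sub, ← map_sub, LinearIsometryEquiv.norm_map]

/-- The added product is positive when both points lie strictly on the same side of the plane. This
is what makes the kernel at `y` larger than the kernel at its mirror image. -/
theorem norm_sub_hyperplaneReflection_sq (hν : ‖ν‖ = 1) (a : ℝ) (x y : E) :
    ‖x - hyperplaneReflection x₀ ν a y‖ ^ 2 =
      ‖x - y‖ ^ 2 + 4 * (a - inner ℝ (x - x₀) ν) * (a - inner ℝ (y - x₀) ν) := by
  have h : x - hyperplaneReflection x₀ ν a y =
      (x - y) - (2 * (a - inner ℝ (y - x₀) ν)) • ν := by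
    unfold hyperplaneReflection
    abel
  have h2 : inner ℝ (x - y) ν = inner ℝ (x - x₀) ν - inner ℝ (y - x₀) ν := by
    rw [← inner_sub_left]
    congr 1
    abel
  rw [h, norm_sub_sq_real, real_inner_smul_right, norm_smul, hν, h2, mul_one, Real.norm_eq_abs,
    sq_abs]
  ring

theorem norm_sub_lt_norm_sub_hyperplaneReflection (hν : ‖ν‖ = 1) {a : ℝ} {x y : E}
    (hx : inner ℝ (x - x₀) ν < a) (hy : inner ℝ (y - x₀) ν < a) :
    ‖x - y‖ < ‖x - hyperplaneReflection x₀ ν a y‖ := by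
  refine lt_of_pow_lt_pow_left₀ 2 (norm_nonneg _) ?_
  rw [norm_sub_hyperplaneReflection_sq hν]
  have := mul_pos (sub_pos.mpr hx) (sub_pos.mpr hy)
  nlinarith

theorem laplacian_comp_hyperplaneReflection [FiniteDimensional ℝ E] (hν : ‖ν‖ = 1) (a : ℝ)
    {f : E → ℝ} {x : E} (hf : ContDiffAt ℝ 2 f (hyperplaneReflection x₀ ν a x)) :
    Laplacian.laplacian (fun y => f (hyperplaneReflection x₀ ν a y)) x =
      Laplacian.laplacian f (hyperplaneReflection x₀ ν a x) := by
  have h := hyperplaneReflection_eq_reflection_add (x₀ := x₀) hν a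
  simp only [h] at hf ⊢
  exact hf.laplacian_comp_isometry_add _ _

theorem contDiff_hyperplaneReflection {k : WithTop ℕ∞} (a : ℝ) :
    ContDiff ℝ k (hyperplaneReflection x₀ ν a) := by
  unfold hyperplaneReflection
  exact contDiff_id.add ((contDiff_const.mul (contDiff_const.sub
    ((contDiff_id.sub contDiff_const).inner ℝ contDiff_const))).smul contDiff_const)

theorem measurePreserving_hyperplaneReflection [FiniteDimensional ℝ E] [MeasurableSpace E]
    [BorelSpace E] (hν : ‖ν‖ = 1) (a : ℝ) :
    MeasurePreserving (hyperplaneReflection x₀ ν a) (volume : Measure E) volume := by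
  have h : hyperplaneReflection x₀ ν a = (fun y => y + (2 * (a + inner ℝ x₀ ν)) • ν) ∘
      (Submodule.span ℝ {ν})ᗮ.reflection := by
    funext x
    exact hyperplaneReflection_eq_reflection_add hν a x
  rw [h]
  exact (measurePreserving_add_right volume _).comp (LinearIsometryEquiv.measurePreserving _)

theorem measurableEmbedding_hyperplaneReflection [MeasurableSpace E]
    [BorelSpace E] (hν : ‖ν‖ = 1) (a : ℝ) :
    MeasurableEmbedding (hyperplaneReflection x₀ ν a) :=
  (Homeomorph.mk ⟨hyperplaneReflection x₀ ν a, hyperplaneReflection x₀ ν a,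
    hyperplaneReflection_hyperplaneReflection hν a, hyperplaneReflection_hyperplaneReflection hν a⟩
    (continuous_hyperplaneReflection a) (continuous_hyperplaneReflection a)).measurableEmbedding

end HyperplaneReflection

/-! ### Caps of a strictly convex domain -/

section Caps

variable {n : ℕ} {Ω : Set (En n)} {x₀ ν : En n}

theorem IsLocalDefiningFunction.hasDerivAt_line {ρ : En n → ℝ}
    (h : IsLocalDefiningFunction Ω x₀ ρ) (v : En n) :
    HasDerivAt (fun t : ℝ => ρ (x₀ + t • v)) (inner ℝ (gradient ρ x₀) v) 0 := by
  obtain ⟨U, hU, hs⟩ := h.smooth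
  have hd : DifferentiableAt ℝ ρ x₀ := (hs.contDiffAt hU).differentiableAt (by simp)
  have hl : HasDerivAt (fun t : ℝ => x₀ + t • v) v 0 := by
    simpa using ((hasDerivAt_id (0 : ℝ)).smul_const v).const_add x₀
  have hf : HasFDerivAt ρ (InnerProductSpace.toDual ℝ (En n) (gradient ρ x₀))
      (x₀ + (0 : ℝ) • v) := by
    simpa using hd.hasGradientAt.hasFDerivAt
  exact hf.comp_hasDerivAt (0 : ℝ) hl

theorem IsLocalDefiningFunction.eventually_mem {ρ : En n → ℝ}
    (h : IsLocalDefiningFunction Ω x₀ ρ) {v : En n} (hv : 0 < inner ℝ (gradient ρ x₀) v) :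
    ∀ᶠ t : ℝ in 𝓝[>] 0, x₀ + t • v ∈ Ω := by
  have ht := (h.hasDerivAt_line v).tendsto_slope_zero_right
  have hc : Tendsto (fun t : ℝ => x₀ + t • v) (𝓝[>] 0) (𝓝 x₀) := by
    have : ContinuousAt (fun t : ℝ => x₀ + t • v) 0 := by fun_prop
    simpa using this.tendsto.mono_left nhdsWithin_le_nhds
  filter_upwards [ht.eventually (lt_mem_nhds hv), hc.eventually h.eventually_mem_iff,
    self_mem_nhdsWithin] with t h1 h2 h3
  rw [h2]
  simp only [zero_add, zero_smul, add_zero, h.zero, sub_zero, smul_eq_mul] at h1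
  exact (mul_pos_iff_of_pos_left (inv_pos.mpr h3)).mp h1

theorem IsLocalDefiningFunction.eventually_notMem {ρ : En n → ℝ}
    (h : IsLocalDefiningFunction Ω x₀ ρ) {v : En n} (hv : inner ℝ (gradient ρ x₀) v < 0) :
    ∀ᶠ t : ℝ in 𝓝[>] 0, x₀ + t • v ∉ Ω := by
  have ht := (h.hasDerivAt_line v).tendsto_slope_zero_right
  have hc : Tendsto (fun t : ℝ => x₀ + t • v) (𝓝[>] 0) (𝓝 x₀) := by
    have : ContinuousAt (fun t : ℝ => x₀ + t • v) 0 := by fun_prop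
    simpa using this.tendsto.mono_left nhdsWithin_le_nhds
  filter_upwards [ht.eventually (gt_mem_nhds hv), hc.eventually h.eventually_mem_iff,
    self_mem_nhdsWithin] with t h1 h2 h3
  rw [h2, not_lt]
  simp only [zero_add, zero_smul, add_zero, h.zero, sub_zero, smul_eq_mul] at h1
  by_contra! hpos
  exact absurd h1 (not_lt.mpr (mul_pos (inv_pos.mpr h3) hpos).le)

theorem IsInwardUnitNormal.norm_eq_one (h : IsInwardUnitNormal Ω x₀ ν) : ‖ν‖ = 1 := by
  obtain ⟨ρ, hρ, rfl⟩ := h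
  exact norm_smul_inv_norm (𝕜 := ℝ) hρ.grad_ne_zero

theorem IsSmoothStrictlyConvexDomain.isCompact_closure (hΩ : IsSmoothStrictlyConvexDomain Ω) :
    IsCompact (closure Ω) :=
  hΩ.isBounded.isCompact_closure

theorem IsSmoothStrictlyConvexDomain.interior_closure (hΩ : IsSmoothStrictlyConvexDomain Ω) :
    interior (closure Ω) = Ω := by
  rw [hΩ.convex.interior_closure_eq_interior_of_nonempty_interior
    (by rw [hΩ.isOpen.interior_eq]; exact hΩ.nonempty), hΩ.isOpen.interior_eq]

theorem IsSmoothStrictlyConvexDomain.uniqueDiffOn_closure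
    (hΩ : IsSmoothStrictlyConvexDomain Ω) : UniqueDiffOn ℝ (closure Ω) :=
  uniqueDiffOn_convex hΩ.convex.closure (by rw [hΩ.interior_closure]; exact hΩ.nonempty)

theorem IsSmoothStrictlyConvexDomain.add_smul_mem (hΩ : IsSmoothStrictlyConvexDomain Ω)
    {x v : En n} {t h : ℝ} (hx : x ∈ closure Ω) (hxt : x + t • v ∈ Ω) (hh : 0 < h) (hht : h ≤ t) :
    x + h • v ∈ Ω := by
  have ht : 0 < t := hh.trans_le hht
  have hint : x + t • v ∈ interior Ω := by rwa [hΩ.isOpen.interior_eq]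
  have := hΩ.convex.combo_closure_interior_mem_interior hx hint (a := 1 - h / t) (b := h / t)
    (by rw [sub_nonneg, div_le_one ht]; exact hht) (by positivity) (by ring)
  rw [hΩ.isOpen.interior_eq] at this
  convert this using 1
  rw [smul_add, smul_smul, div_mul_cancel₀ _ ht.ne', ← add_assoc, ← add_smul]
  simp

/-- The tangent plane supports `Ω`: a segment from `x₀` to a point of `Ω` with negative height would
leave `Ω` at first order, whereas convexity keeps it inside. -/
theorem IsSmoothStrictlyConvexDomain.inner_nonneg (hΩ : IsSmoothStrictlyConvexDomain Ω)
    (hx₀ : x₀ ∈ frontier Ω) (hν : IsInwardUnitNormal Ω x₀ ν) {x : En n} (hx : x ∈ closure Ω) :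
    0 ≤ inner ℝ (x - x₀) ν := by
  have hcl : IsClosed {y : En n | 0 ≤ inner ℝ (y - x₀) ν} :=
    isClosed_le continuous_const (by fun_prop)
  refine closure_minimal (fun y hy => ?_) hcl hx
  obtain ⟨ρ, hρ, rfl⟩ := hν
  by_contra! hneg
  simp only [mem_ofPred_eq, not_le, real_inner_smul_right] at hneg
  have hg : 0 < ‖gradient ρ x₀‖⁻¹ := inv_pos.mpr (norm_pos_iff.mpr hρ.grad_ne_zero)
  have hneg' : inner ℝ (gradient ρ x₀) (y - x₀) < 0 := by
    rw [real_inner_comm]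
    by_contra! h
    exact absurd hneg (not_lt.mpr (mul_nonneg hg.le h))
  obtain ⟨t, ht, htpos, ht1⟩ := ((hρ.eventually_notMem hneg').and
    (Ioo_mem_nhdsGT (zero_lt_one : (0 : ℝ) < 1))).exists
  exact ht (hΩ.add_smul_mem (frontier_subset_closure hx₀) (t := 1) (by simpa using hy) htpos
    ht1.le)

theorem IsSmoothStrictlyConvexDomain.inner_pos (hΩ : IsSmoothStrictlyConvexDomain Ω)
    (hx₀ : x₀ ∈ frontier Ω) (hν : IsInwardUnitNormal Ω x₀ ν) {x : En n} (hx : x ∈ Ω) :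
    0 < inner ℝ (x - x₀) ν := by
  have hc : Tendsto (fun t : ℝ => x - t • ν) (𝓝[>] 0) (𝓝 x) := by
    have : ContinuousAt (fun t : ℝ => x - t • ν) 0 := by fun_prop
    simpa using this.tendsto.mono_left nhdsWithin_le_nhds
  obtain ⟨t, ht, htpos⟩ := ((hc.eventually (hΩ.isOpen.mem_nhds hx)).and
    (self_mem_nhdsWithin : Ioi (0 : ℝ) ∈ 𝓝[>] 0)).exists
  have h := hΩ.inner_nonneg hx₀ hν (subset_closure ht)
  rw [sub_right_comm, inner_sub_left, real_inner_smul_left, real_inner_self_eq_norm_sq,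
    hν.norm_eq_one] at h
  have : (0 : ℝ) < t := htpos
  linarith

/-- A second contact point would, by strict convexity of the closure, put the midpoint into `Ω`,
where the height is positive. -/
theorem IsSmoothStrictlyConvexDomain.eq_of_inner_eq_zero (hΩ : IsSmoothStrictlyConvexDomain Ω)
    (hx₀ : x₀ ∈ frontier Ω) (hν : IsInwardUnitNormal Ω x₀ ν) {x : En n} (hx : x ∈ closure Ω)
    (h0 : inner ℝ (x - x₀) ν = 0) : x = x₀ := by
  by_contra hne
  have hmid := hΩ.strictConvex_closure hx (frontier_subset_closure hx₀) hne
    (a := 1 / 2) (b := 1 / 2) (by norm_num) (by norm_num) (by norm_num)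
  rw [hΩ.interior_closure] at hmid
  have hpos := hΩ.inner_pos hx₀ hν hmid
  have : (1 / 2 : ℝ) • x + (1 / 2 : ℝ) • x₀ - x₀ = (1 / 2 : ℝ) • (x - x₀) := by module
  rw [this, real_inner_smul_left, h0] at hpos
  simp at hpos

/-- Small caps concentrate at the boundary point, so short translates of their points in the
inward normal direction stay in the domain. -/
theorem IsSmoothStrictlyConvexDomain.exists_cap_translate_mem
    (hΩ : IsSmoothStrictlyConvexDomain Ω) (hx₀ : x₀ ∈ frontier Ω)
    (hν : IsInwardUnitNormal Ω x₀ ν) :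
    ∃ δ : ℝ, 0 < δ ∧ ∀ x ∈ closure Ω, inner ℝ (x - x₀) ν ≤ δ → ∀ h : ℝ, 0 < h → h ≤ 2 * δ →
      x + h • ν ∈ Ω := by
  obtain ⟨t, ht, htΩ⟩ : ∃ t : ℝ, 0 < t ∧ x₀ + t • ν ∈ Ω := by
    obtain ⟨ρ, hρ, hνρ⟩ := id hν
    have hg : 0 < ‖gradient ρ x₀‖ := norm_pos_iff.mpr hρ.grad_ne_zero
    have hpos : 0 < inner ℝ (gradient ρ x₀) ν := by
      rw [hνρ, real_inner_smul_right, real_inner_self_eq_norm_sq]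
      positivity
    obtain ⟨t, h1, h2⟩ := ((hρ.eventually_mem hpos).and
      (self_mem_nhdsWithin : Ioi (0 : ℝ) ∈ 𝓝[>] 0)).exists
    exact ⟨t, h2, h1⟩
  obtain ⟨ε, hε, hball⟩ := Metric.isOpen_iff.mp hΩ.isOpen _ htΩ
  -- Off the ball around `x₀` the height has a positive minimum by compactness and uniqueness of the
  -- contact point; half of that minimum serves as `δ`.
  obtain ⟨δ, hδ, hδx⟩ : ∃ δ : ℝ, 0 < δ ∧ ∀ x ∈ closure Ω, inner ℝ (x - x₀) ν ≤ δ →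
      x ∈ Metric.ball x₀ ε := by
    have hK : IsCompact (closure Ω \ Metric.ball x₀ ε) :=
      hΩ.isCompact_closure.diff Metric.isOpen_ball
    rcases (closure Ω \ Metric.ball x₀ ε).eq_empty_or_nonempty with hemp | hne
    · exact ⟨1, one_pos, fun x hx _ => by
        by_contra hxb
        exact notMem_empty x (hemp ▸ ⟨hx, hxb⟩)⟩
    · obtain ⟨z, hz, hzmin⟩ := hK.exists_isMinOn hne
        (f := fun x => inner ℝ (x - x₀) ν) (by fun_prop)
      have hzpos : 0 < inner ℝ (z - x₀) ν := by
        refine lt_of_le_of_ne (hΩ.inner_nonneg hx₀ hν hz.1) fun h => hz.2 ?_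
        rw [hΩ.eq_of_inner_eq_zero hx₀ hν hz.1 h.symm]
        exact Metric.mem_ball_self hε
      refine ⟨inner ℝ (z - x₀) ν / 2, by positivity, fun x hx hxle => ?_⟩
      by_contra hxb
      have : inner ℝ (z - x₀) ν ≤ inner ℝ (x - x₀) ν := hzmin ⟨hx, hxb⟩
      linarith
  -- Since `x` is within `ε` of `x₀`, the point `x + t • ν` lies in the ball around `x₀ + t • ν`,
  -- and convexity fills the segment. The bound `t / 2` ensures that `2 * δ` does not exceed `t`.
  refine ⟨min δ (t / 2), lt_min hδ (by positivity), fun x hx hxd h hh hh2 => ?_⟩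
  have hxball := hδx x hx (hxd.trans (min_le_left _ _))
  refine hΩ.add_smul_mem hx (t := t) (hball ?_) hh
    (hh2.trans (by linarith [min_le_right δ (t / 2)]))
  rw [Metric.mem_ball, dist_add_right]
  exact hxball

end Caps

/-! ### The fractional Laplacian at minimum points -/

section FractionalLaplacian

variable {n : ℕ} {σ : ℝ}

theorem fracLaplacianConst_pos (hσ : σ ∈ Ioo (0 : ℝ) 1) : 0 < fracLaplacianConst n σ := by
  have h1 : 0 < σ := hσ.1
  have h2 : 0 < Real.Gamma ((n : ℝ) / 2 + σ) := Real.Gamma_pos_of_pos (by positivity)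
  have h3 : 0 < Real.Gamma (1 - σ) := Real.Gamma_pos_of_pos (sub_pos.mpr hσ.2)
  unfold fracLaplacianConst
  positivity

theorem HasFracLaplacianAt.nonpos_of_forall_le {w : En n → ℝ} {x : En n} {L : ℝ}
    (hσ : σ ∈ Ioo (0 : ℝ) 1) (h : HasFracLaplacianAt σ w x L) (hmin : ∀ y, w x ≤ w y) : L ≤ 0 := by
  refine le_of_tendsto h.2 (Eventually.of_forall fun δ => ?_)
  refine mul_nonpos_of_nonneg_of_nonpos (fracLaplacianConst_pos hσ).le ?_
  exact integral_nonpos fun y =>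
    div_nonpos_of_nonpos_of_nonneg (sub_nonpos.mpr (hmin y)) (by positivity)

theorem integrableOn_inv_norm_sub_rpow (hσ : 0 < σ) (x : En n) {δ : ℝ} (hδ : 0 < δ) :
    IntegrableOn (fun y : En n => (‖x - y‖ ^ ((n : ℝ) + 2 * σ))⁻¹) (Metric.ball x δ)ᶜ := by
  set α : ℝ := (n : ℝ) + 2 * σ with hα
  have hα0 : 0 < α := by positivity
  -- Outside the ball `1 + ‖x - y‖ ≤ (1 / δ + 1) * ‖x - y‖`, so this integrable function dominates
  -- the kernel.
  have hint : Integrable fun y : En n => (1 / δ + 1) ^ α * (1 + ‖x - y‖) ^ (-α) := by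
    have h := integrable_one_add_norm (E := En n) (μ := volume) (r := α)
      (by rw [finrank_euclideanSpace_fin, hα]; linarith)
    exact (h.comp_sub_left x).const_mul _
  refine Integrable.mono' hint.integrableOn ?_ ?_
  · refine Measurable.aestronglyMeasurable ?_
    fun_prop
  · refine (ae_restrict_iff' Metric.isOpen_ball.measurableSet.compl).mpr
      (Eventually.of_forall fun y hy => ?_)
    have hyδ : δ ≤ ‖x - y‖ := by
      rw [mem_compl_iff, Metric.mem_ball, not_lt, dist_comm, dist_eq_norm] at hy
      exact hy
    have hpos : 0 < ‖x - y‖ := hδ.trans_le hyδ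
    rw [Real.norm_of_nonneg (by positivity), Real.rpow_neg (by positivity),
      inv_eq_one_div, div_le_iff₀ (by positivity), mul_assoc, mul_comm _ (‖x - y‖ ^ α),
      ← mul_assoc, ← div_eq_mul_inv, le_div_iff₀ (by positivity), one_mul,
      ← Real.mul_rpow (by positivity) hpos.le]
    refine Real.rpow_le_rpow (by positivity) ?_ hα0.le
    have : 1 ≤ 1 / δ * ‖x - y‖ := by
      rw [one_div, inv_mul_eq_div, le_div_iff₀ hδ]
      linarith
    linarith

theorem integrableOn_div_norm_sub_rpow (hσ : 0 < σ) {f : En n → ℝ} (hf : Continuous f) {B : ℝ}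
    (hB : ∀ y, |f y| ≤ B) (x : En n) {δ : ℝ} (hδ : 0 < δ) :
    IntegrableOn (fun y : En n => f y / ‖x - y‖ ^ ((n : ℝ) + 2 * σ)) (Metric.ball x δ)ᶜ := by
  simp only [div_eq_mul_inv]
  exact (integrableOn_inv_norm_sub_rpow hσ x hδ).bdd_mul hf.aestronglyMeasurable
    (Eventually.of_forall hB)

variable {x₀ ν : En n}

/-- The difference of a function and its reflection has a fractional Laplacian where the function
has one at both points. -/
theorem HasFracLaplacianAt.tendsto_reflection_sub (hσ : 0 < σ) (hν : ‖ν‖ = 1) {a : ℝ}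
    {w : En n → ℝ} (hw : Continuous w) {B : ℝ} (hB : ∀ y, |w y| ≤ B) {x : En n} {L₁ L₂ : ℝ}
    (h₁ : HasFracLaplacianAt σ w x L₁)
    (h₂ : HasFracLaplacianAt σ w (hyperplaneReflection x₀ ν a x) L₂) :
    Tendsto (fun δ : ℝ => fracLaplacianConst n σ * ∫ y in (Metric.ball x δ)ᶜ,
      ((w (hyperplaneReflection x₀ ν a x) - w x) - (w (hyperplaneReflection x₀ ν a y) - w y)) /
        ‖x - y‖ ^ ((n : ℝ) + 2 * σ)) (𝓝[>] 0) (𝓝 (L₂ - L₁)) := by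
  set R := hyperplaneReflection x₀ ν a with hR
  refine (h₂.2.sub h₁.2).congr' ?_
  filter_upwards [self_mem_nhdsWithin] with δ hδ
  have hδ : 0 < δ := hδ
  have hchange : ∫ y in (Metric.ball (R x) δ)ᶜ, (w (R x) - w y) / ‖R x - y‖ ^ ((n : ℝ) + 2 * σ) =
      ∫ y in (Metric.ball x δ)ᶜ, (w (R x) - w (R y)) / ‖x - y‖ ^ ((n : ℝ) + 2 * σ) := by
    rw [← (measurePreserving_hyperplaneReflection hν a).setIntegral_preimage_emb
      (measurableEmbedding_hyperplaneReflection hν a)]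
    have hpre : hyperplaneReflection x₀ ν a ⁻¹' (Metric.ball (R x) δ)ᶜ = (Metric.ball x δ)ᶜ := by
      ext y
      simp only [mem_preimage, mem_compl_iff, Metric.mem_ball, dist_eq_norm, hR,
        norm_hyperplaneReflection_sub hν]
    rw [hpre]
    simp only [hR, norm_hyperplaneReflection_sub hν]
  rw [hchange, ← mul_sub, ← integral_sub]
  · congr 2
    funext y
    ring
  · refine integrableOn_div_norm_sub_rpow hσ (B := B + B) ?_ (fun y => ?_) x hδ
    · exact continuous_const.sub (hw.comp (continuous_hyperplaneReflection a))
    · exact (abs_sub _ _).trans (add_le_add (hB _) (hB _))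
  · refine integrableOn_div_norm_sub_rpow hσ (B := B + B) (by fun_prop) (fun y => ?_) x hδ
    exact (abs_sub _ _).trans (add_le_add (hB _) (hB _))

theorem tendsto_volume_real_ball_zero (hn : n ≠ 0) (x : En n) :
    Tendsto (fun δ : ℝ => volume.real (Metric.ball x δ)) (𝓝[>] 0) (𝓝 0) := by
  have h : Tendsto (fun δ : ℝ => δ ^ n * volume.real (Metric.ball (0 : En n) 1)) (𝓝[>] 0)
      (𝓝 0) := by
    have hc : Continuous fun δ : ℝ => δ ^ n * volume.real (Metric.ball (0 : En n) 1) := by fun_prop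
    have := (hc.tendsto 0).mono_left (nhdsWithin_le_nhds (s := Ioi 0))
    simpa [hn] using this
  refine h.congr' ?_
  filter_upwards [self_mem_nhdsWithin] with δ hδ
  have hδ : 0 < δ := hδ
  rw [measureReal_def, measureReal_def, Measure.addHaar_ball_of_pos volume x hδ,
    finrank_euclideanSpace_fin, ENNReal.toReal_mul, ENNReal.toReal_ofReal (by positivity)]

/-- Upper bound for the fractional Laplacian of an antisymmetric function at a nonpositive minimum
point over the half-space. -/
theorem fracLaplacian_antisymmetric_le (hn : n ≠ 0) (hσ : σ ∈ Ioo (0 : ℝ) 1) (hν : ‖ν‖ = 1) {a : ℝ}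
    {U : En n → ℝ} (hU : Continuous U) {B : ℝ} (hB : ∀ y, |U y| ≤ B)
    (hanti : ∀ y, U (hyperplaneReflection x₀ ν a y) = -U y) {x : En n} {L : ℝ}
    (hL : Tendsto (fun δ : ℝ => fracLaplacianConst n σ * ∫ y in (Metric.ball x δ)ᶜ,
      (U x - U y) / ‖x - y‖ ^ ((n : ℝ) + 2 * σ)) (𝓝[>] 0) (𝓝 L))
    (hx : inner ℝ (x - x₀) ν < a) (hUx : U x ≤ 0)
    (hmin : ∀ y, inner ℝ (y - x₀) ν < a → U x ≤ U y)
    {A : Set (En n)} (hA : MeasurableSet A) (hAa : ∀ y ∈ A, inner ℝ (y - x₀) ν < a)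
    {r : ℝ} (hr : 0 < r) (hAr : ∀ y ∈ A, r ≤ ‖x - y‖) :
    IntegrableOn (fun y => (U x - U y) * ((‖x - y‖ ^ ((n : ℝ) + 2 * σ))⁻¹ -
        (‖x - hyperplaneReflection x₀ ν a y‖ ^ ((n : ℝ) + 2 * σ))⁻¹) +
        2 * U x * (‖x - hyperplaneReflection x₀ ν a y‖ ^ ((n : ℝ) + 2 * σ))⁻¹) A ∧
      L ≤ fracLaplacianConst n σ * ∫ y in A, ((U x - U y) * ((‖x - y‖ ^ ((n : ℝ) + 2 * σ))⁻¹ -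
        (‖x - hyperplaneReflection x₀ ν a y‖ ^ ((n : ℝ) + 2 * σ))⁻¹) +
        2 * U x * (‖x - hyperplaneReflection x₀ ν a y‖ ^ ((n : ℝ) + 2 * σ))⁻¹) := by
  set α : ℝ := (n : ℝ) + 2 * σ with hα
  have hσ0 : 0 < σ := hσ.1
  have hα0 : 0 < α := by positivity
  set R := hyperplaneReflection x₀ ν a with hR
  set k : En n → ℝ := fun y => (‖x - y‖ ^ α)⁻¹ with hk
  set k' : En n → ℝ := fun y => (‖x - R y‖ ^ α)⁻¹ with hk'
  set S : Set (En n) := {y | inner ℝ (y - x₀) ν < a} with hS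
  have hmemS : ∀ y, y ∈ S ↔ inner ℝ (y - x₀) ν < a := fun y => Iff.rfl
  have hSm : MeasurableSet S := (isOpen_lt (by fun_prop) continuous_const).measurableSet
  set D : ℝ := a - inner ℝ (x - x₀) ν with hD
  have hDpos : 0 < D := sub_pos.mpr hx
  have hdist : ∀ y, a ≤ inner ℝ (y - x₀) ν → D ≤ ‖x - y‖ := by
    intro y hy
    have h1 : inner ℝ (y - x) ν = inner ℝ (y - x₀) ν - inner ℝ (x - x₀) ν := by
      rw [← inner_sub_left]; congr 1; abel
    have h2 := real_inner_le_norm (y - x) ν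
    rw [hν, mul_one, norm_sub_rev, h1] at h2
    linarith
  have hdistR : ∀ y, inner ℝ (y - x₀) ν ≤ a → D ≤ ‖x - R y‖ := fun y hy => by
    refine hdist _ ?_
    rw [hR, inner_hyperplaneReflection_sub hν]
    linarith
  have hkk' : ∀ y ∈ S, x ≠ y → k' y ≤ k y := fun y hy hne => by
    have hpos : 0 < ‖x - y‖ := norm_pos_iff.mpr (sub_ne_zero.mpr hne)
    refine inv_anti₀ (by positivity) (Real.rpow_le_rpow hpos.le ?_ hα0.le)
    exact (norm_sub_lt_norm_sub_hyperplaneReflection hν hx hy).le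
  have hk'0 : ∀ y, 0 ≤ k' y := fun y => by positivity
  -- Folding by antisymmetry produces `(U x - U y) * k + (U x + U y) * k'`. Regrouped in this way,
  -- both terms are nonpositive, because `k' ≤ k` on `S` and `U x` is a nonpositive minimum there.
  set G : En n → ℝ := fun y => (U x - U y) * (k y - k' y) + 2 * U x * k' y with hG
  have hG0 : ∀ y ∈ S, x ≠ y → G y ≤ 0 := fun y hy hne => by
    have h1 : (U x - U y) * (k y - k' y) ≤ 0 :=
      mul_nonpos_of_nonpos_of_nonneg (sub_nonpos.mpr (hmin y hy)) (sub_nonneg.mpr (hkk' y hy hne))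
    have h2 : 2 * U x * k' y ≤ 0 :=
      mul_nonpos_of_nonpos_of_nonneg (by linarith) (hk'0 y)
    simp only [hG]
    linarith
  have hcl : IntegrableOn k' {y : En n | inner ℝ (y - x₀) ν ≤ a} := by
    have h1 : IntegrableOn k {y : En n | a ≤ inner ℝ (y - x₀) ν} := by
      refine (integrableOn_inv_norm_sub_rpow hσ0 x hDpos).mono_set fun y hy => ?_
      rw [mem_compl_iff, Metric.mem_ball, not_lt, dist_comm, dist_eq_norm]
      exact hdist y hy
    have h2 := ((measurePreserving_hyperplaneReflection (x₀ := x₀) hν a).integrableOn_comp_preimage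
      (measurableEmbedding_hyperplaneReflection hν a)).mpr h1
    refine h2.mono_set fun y hy => ?_
    simp only [mem_preimage, mem_ofPred_eq, inner_hyperplaneReflection_sub hν] at hy ⊢
    linarith
  have hk'S : IntegrableOn k' S := hcl.mono_set fun y hy => mem_ofPred.mpr ((hmemS y).mp hy).le
  have hbd : ∀ {T : Set (En n)} {f g : En n → ℝ}, IntegrableOn f T → Continuous g →
      (∀ y, |g y| ≤ B + B) → IntegrableOn (fun y => g y * f y) T := fun hf hg hgB =>
    Integrable.bdd_mul hf hg.aestronglyMeasurable (Eventually.of_forall hgB)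
  have hbm : ∀ y, |U x - U y| ≤ B + B := fun y => (abs_sub _ _).trans (add_le_add (hB _) (hB _))
  have hbp : ∀ y, |U x + U y| ≤ B + B := fun y =>
    (abs_add_le _ _).trans (add_le_add (hB _) (hB _))
  have hcm : Continuous fun y => U x - U y := by fun_prop
  have hcp : Continuous fun y => U x + U y := by fun_prop
  have hkint : ∀ δ > 0, IntegrableOn k (Metric.ball x δ)ᶜ := fun δ hδ =>
    integrableOn_inv_norm_sub_rpow hσ0 x hδ
  have hGeq : G = fun y => (U x - U y) * k y + (U x + U y) * k' y := by
    funext y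
    simp only [hG]
    ring
  have hGint : ∀ δ > 0, IntegrableOn G (S \ Metric.ball x δ) := fun δ hδ => by
    rw [hGeq]
    exact (hbd ((hkint δ hδ).mono_set fun y hy => hy.2) hcm hbm).add
      (hbd (hk'S.mono_set sdiff_subset) hcp hbp)
  have hAsub : ∀ δ ≤ r, A ⊆ S \ Metric.ball x δ := fun δ hδ y hy =>
    ⟨hAa y hy, by
      rw [Metric.mem_ball, not_lt, dist_comm, dist_eq_norm]
      exact hδ.trans (hAr y hy)⟩
  refine ⟨(hGint r hr).mono_set (hAsub r le_rfl), ?_⟩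
  have hC := fracLaplacianConst_pos (n := n) hσ
  have hfin : Tendsto (fun δ : ℝ => fracLaplacianConst n σ * ((∫ y in A, G y) +
      (B + B) * (D ^ α)⁻¹ * volume.real (Metric.ball x δ))) (𝓝[>] 0)
      (𝓝 (fracLaplacianConst n σ * ∫ y in A, G y)) := by
    have := (((tendsto_volume_real_ball_zero hn x).const_mul ((B + B) * (D ^ α)⁻¹)).const_add
      (∫ y in A, G y)).const_mul (fracLaplacianConst n σ)
    simpa using this
  refine le_of_tendsto_of_tendsto hL hfin ?_
  filter_upwards [Ioo_mem_nhdsGT (lt_min hr hDpos)] with δ hδ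
  have hδ0 : 0 < δ := hδ.1
  have hδr : δ ≤ r := hδ.2.le.trans (min_le_left _ _)
  have hδD : δ ≤ D := hδ.2.le.trans (min_le_right _ _)
  refine mul_le_mul_of_nonneg_left ?_ hC.le
  have hballS : Metric.ball x δ ⊆ S := fun y hy => by
    by_contra hyS
    rw [Metric.mem_ball, dist_comm, dist_eq_norm] at hy
    exact absurd (hdist y (not_lt.mp hyS)) (not_le.mpr (hy.trans_le hδD))
  have hsplit : (Metric.ball x δ)ᶜ = (S \ Metric.ball x δ) ∪ Sᶜ := by
    ext y
    constructor
    · intro hy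
      by_cases hyS : y ∈ S
      · exact Or.inl ⟨hyS, hy⟩
      · exact Or.inr hyS
    · rintro (hy | hy)
      · exact hy.2
      · exact fun h => hy (hballS h)
  have hdisj : Disjoint (S \ Metric.ball x δ) Sᶜ :=
    disjoint_compl_right.mono_left sdiff_subset
  have hI : IntegrableOn (fun y => (U x - U y) * k y) (Metric.ball x δ)ᶜ :=
    hbd (hkint δ hδ0) hcm hbm
  have hballm : MeasurableSet (Metric.ball x δ) := Metric.isOpen_ball.measurableSet
  -- The preimage of `Sᶜ` is `S` together with the plane itself. On the plane `U` vanishes by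
  -- antisymmetry, so its contribution has the favourable sign and an inequality suffices.
  have hfar : ∫ y in Sᶜ, (U x - U y) * k y ≤ ∫ y in S, (U x + U y) * k' y := by
    rw [← (measurePreserving_hyperplaneReflection (x₀ := x₀) hν a).setIntegral_preimage_emb
      (measurableEmbedding_hyperplaneReflection hν a)]
    have hpre : hyperplaneReflection x₀ ν a ⁻¹' Sᶜ = S ∪ {y | inner ℝ (y - x₀) ν = a} := by
      ext y
      simp only [mem_preimage, mem_compl_iff, hS, mem_union, mem_ofPred_eq,
        inner_hyperplaneReflection_sub hν, not_lt]
      rw [← le_iff_lt_or_eq]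
      constructor <;> intro h <;> linarith
    have hTm : MeasurableSet {y : En n | inner ℝ (y - x₀) ν = a} :=
      (isClosed_eq (by fun_prop) continuous_const).measurableSet
    have hint : IntegrableOn (fun y => (U x + U y) * k' y) {y | inner ℝ (y - x₀) ν ≤ a} :=
      hbd hcl hcp hbp
    have hcongr : ∀ y, (U x - U (hyperplaneReflection x₀ ν a y)) *
        k (hyperplaneReflection x₀ ν a y) = (U x + U y) * k' y := fun y => by
      rw [hanti y, sub_neg_eq_add]
    simp only [hcongr]
    rw [hpre, setIntegral_union ?_ hTm (hint.mono_set fun y hy => mem_ofPred.mpr ((hmemS y).mp hy).le)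
      (hint.mono_set fun y hy => mem_ofPred.mpr (mem_ofPred.mp hy).le)]
    · have hT : ∫ y in {y : En n | inner ℝ (y - x₀) ν = a}, (U x + U y) * k' y ≤ 0 := by
        refine setIntegral_nonpos hTm fun y hy => ?_
        have h0 := hanti y
        rw [hR, hyperplaneReflection_of_inner_eq (mem_ofPred.mp hy)] at h0
        have : U y = 0 := by linarith
        rw [this, add_zero]
        exact mul_nonpos_of_nonpos_of_nonneg hUx (hk'0 y)
      linarith
    · rw [Set.disjoint_left]
      intro y hy hy'
      exact absurd hy' (ne_of_lt hy)
  have hnear : ∫ y in Metric.ball x δ, (U x + U y) * k' y ≤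
      (B + B) * (D ^ α)⁻¹ * volume.real (Metric.ball x δ) := by
    refine (le_abs_self _).trans ?_
    rw [← Real.norm_eq_abs]
    refine norm_setIntegral_le_of_norm_le_const measure_ball_lt_top fun y hy => ?_
    rw [norm_mul, Real.norm_eq_abs, Real.norm_of_nonneg (hk'0 y)]
    refine mul_le_mul (hbp y) ?_ (hk'0 y) ((abs_nonneg _).trans (hbp y))
    refine inv_anti₀ (by positivity) (Real.rpow_le_rpow hDpos.le ?_ hα0.le)
    exact hdistR y (le_of_lt (hballS hy))
  have hSsplit : ∫ y in S, (U x + U y) * k' y = (∫ y in S \ Metric.ball x δ, (U x + U y) * k' y) +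
      ∫ y in Metric.ball x δ, (U x + U y) * k' y := by
    have hint : IntegrableOn (fun y => (U x + U y) * k' y) S := hbd hk'S hcp hbp
    rw [← setIntegral_union disjoint_sdiff_left hballm (hint.mono_set sdiff_subset)
      (hint.mono_set hballS), sdiff_union_of_subset hballS]
  have hGsum : (∫ y in S \ Metric.ball x δ, (U x - U y) * k y) +
      ∫ y in S \ Metric.ball x δ, (U x + U y) * k' y = ∫ y in S \ Metric.ball x δ, G y := by
    have h1 : IntegrableOn (fun y => (U x - U y) * k y) (S \ Metric.ball x δ) :=
      hI.mono_set fun y hy => hy.2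
    have h2 : IntegrableOn (fun y => (U x + U y) * k' y) (S \ Metric.ball x δ) :=
      hbd (hk'S.mono_set sdiff_subset) hcp hbp
    rw [← integral_add h1 h2, hGeq]
  -- As `G` is nonpositive away from `x`, discarding everything outside `A` only increases the
  -- integral.
  have hGA : ∫ y in S \ Metric.ball x δ, G y ≤ ∫ y in A, G y := by
    have hrest : ∫ y in (S \ Metric.ball x δ) \ A, G y ≤ 0 :=
      setIntegral_nonpos ((hSm.diff hballm).diff hA) fun y hy => hG0 y hy.1.1 fun hxy =>
        hy.1.2 (hxy ▸ Metric.mem_ball_self hδ0)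
    have hsp := setIntegral_union (μ := volume) (f := G) (disjoint_sdiff_left (s := A)
      (t := S \ Metric.ball x δ)) hA ((hGint δ hδ0).mono_set sdiff_subset)
      ((hGint δ hδ0).mono_set (hAsub δ hδr))
    rw [sdiff_union_of_subset (hAsub δ hδr)] at hsp
    linarith
  have hstart : ∫ y in (Metric.ball x δ)ᶜ, (U x - U y) / ‖x - y‖ ^ α =
      (∫ y in S \ Metric.ball x δ, (U x - U y) * k y) + ∫ y in Sᶜ, (U x - U y) * k y := by
    simp only [div_eq_mul_inv]
    rw [hsplit, setIntegral_union hdisj hSm.compl (hI.mono_set fun y hy => hy.2)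
      (hI.mono_set (by rw [hsplit]; exact subset_union_right))]
  rw [hstart]
  linarith

/-- Quantitative bound at a nonpositive minimum point that is close to the reflection
hyperplane. -/
theorem fracLaplacian_antisymmetric_le_of_near (hn : n ≠ 0) (hσ : σ ∈ Ioo (0 : ℝ) 1)
    (hν : ‖ν‖ = 1) {a : ℝ} {U : En n → ℝ} (hU : Continuous U) {B : ℝ} (hB : ∀ y, |U y| ≤ B)
    (hanti : ∀ y, U (hyperplaneReflection x₀ ν a y) = -U y) {x : En n} {L : ℝ}
    (hL : Tendsto (fun δ : ℝ => fracLaplacianConst n σ * ∫ y in (Metric.ball x δ)ᶜ,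
      (U x - U y) / ‖x - y‖ ^ ((n : ℝ) + 2 * σ)) (𝓝[>] 0) (𝓝 L))
    (hx : inner ℝ (x - x₀) ν < a) (hUx : U x ≤ 0)
    (hmin : ∀ y, inner ℝ (y - x₀) ν < a → U x ≤ U y)
    {l : ℝ} (hl : 0 < l) (hxl : a - l ≤ inner ℝ (x - x₀) ν) :
    L ≤ fracLaplacianConst n σ * (2 * U x * ((5 * l) ^ ((n : ℝ) + 2 * σ))⁻¹ *
      (l ^ n * volume.real (Metric.ball (0 : En n) 1))) := by
  have hσ0 : 0 < σ := hσ.1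
  set α : ℝ := (n : ℝ) + 2 * σ with hα
  have hα0 : 0 < α := by positivity
  -- The ball of radius `l` about `z` lies at least `3 * l` above `x` and within `5 * l` of it. As
  -- `x` is at most `l` below the plane, the mirror image of the ball lies at least `l` below `x`,
  -- hence away from the singularity.
  set z : En n := x + (4 * l) • ν with hz
  set A : Set (En n) := hyperplaneReflection x₀ ν a ⁻¹' Metric.ball z l with hA
  have hAm : MeasurableSet A :=
    (continuous_hyperplaneReflection a).measurable Metric.isOpen_ball.measurableSet
  have hball : ∀ y ∈ Metric.ball z l, inner ℝ (x - x₀) ν + 3 * l ≤ inner ℝ (y - x₀) ν ∧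
      ‖x - y‖ ≤ 5 * l := by
    intro y hy
    rw [Metric.mem_ball, dist_eq_norm] at hy
    have h1 : y - x₀ = (x - x₀) + ((4 * l) • ν + (y - z)) := by rw [hz]; abel
    have h2 : -l ≤ inner ℝ (y - z) ν := by
      have := abs_real_inner_le_norm (y - z) ν
      rw [hν, mul_one] at this
      linarith [neg_abs_le (inner ℝ (y - z) ν)]
    constructor
    · rw [h1, inner_add_left, inner_add_left, real_inner_smul_left, real_inner_self_eq_norm_sq, hν]
      linarith
    · have h3 : x - y = -((y - z) + (4 * l) • ν) := by rw [hz]; abel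
      rw [h3, norm_neg]
      refine (norm_add_le _ _).trans ?_
      rw [norm_smul, hν, mul_one, Real.norm_of_nonneg (by positivity)]
      linarith
  have hAbound : ∀ y ∈ A, inner ℝ (y - x₀) ν + l ≤ inner ℝ (x - x₀) ν := fun y hy => by
    have := (hball _ hy).1
    rw [inner_hyperplaneReflection_sub hν] at this
    linarith
  obtain ⟨hint, hle⟩ := fracLaplacian_antisymmetric_le hn hσ hν hU hB hanti hL hx hUx hmin hAm
    (fun y hy => by linarith [hAbound y hy]) hl (fun y hy => by
      have h1 : inner ℝ (x - y) ν = inner ℝ (x - x₀) ν - inner ℝ (y - x₀) ν := by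
        rw [← inner_sub_left]; congr 1; abel
      have h2 := real_inner_le_norm (x - y) ν
      rw [hν, mul_one, h1] at h2
      linarith [hAbound y hy])
  refine hle.trans (mul_le_mul_of_nonneg_left ?_ (fracLaplacianConst_pos hσ).le)
  have hvol : volume.real A = l ^ n * volume.real (Metric.ball (0 : En n) 1) := by
    rw [measureReal_def, hA, (measurePreserving_hyperplaneReflection hν a).measure_preimage
      Metric.isOpen_ball.measurableSet.nullMeasurableSet, Measure.addHaar_ball_of_pos volume z hl,
      finrank_euclideanSpace_fin, ENNReal.toReal_mul, ENNReal.toReal_ofReal (by positivity),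
      measureReal_def]
  have hfin : volume A ≠ ⊤ := by
    rw [hA, (measurePreserving_hyperplaneReflection hν a).measure_preimage
      Metric.isOpen_ball.measurableSet.nullMeasurableSet]
    exact measure_ball_lt_top.ne
  have hconst : ∫ _ in A, 2 * U x * ((5 * l) ^ α)⁻¹ = 2 * U x * ((5 * l) ^ α)⁻¹ *
      (l ^ n * volume.real (Metric.ball (0 : En n) 1)) := by
    rw [setIntegral_const, hvol, smul_eq_mul, mul_comm]
  rw [← hconst]
  refine setIntegral_mono_on hint (integrableOn_const hfin) hAm fun y hy => ?_
  have hya : inner ℝ (y - x₀) ν < a := by linarith [hAbound y hy]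
  have hlt := norm_sub_lt_norm_sub_hyperplaneReflection hν hx hya
  have hxy : 0 < ‖x - y‖ := by
    rw [norm_pos_iff, sub_ne_zero]
    rintro rfl
    linarith [hAbound x hy]
  have h1 : (‖x - hyperplaneReflection x₀ ν a y‖ ^ α)⁻¹ ≤ (‖x - y‖ ^ α)⁻¹ :=
    inv_anti₀ (by positivity) (Real.rpow_le_rpow hxy.le hlt.le hα0.le)
  have h2 : ((5 * l) ^ α)⁻¹ ≤ (‖x - hyperplaneReflection x₀ ν a y‖ ^ α)⁻¹ := by
    have hpos : 0 < ‖x - hyperplaneReflection x₀ ν a y‖ := hxy.trans hlt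
    exact inv_anti₀ (by positivity) (Real.rpow_le_rpow hpos.le (hball _ hy).2 hα0.le)
  have h3 := mul_nonpos_of_nonpos_of_nonneg (sub_nonpos.mpr (hmin y hya)) (sub_nonneg.mpr h1)
  have h4 := mul_le_mul_of_nonpos_left h2 (by linarith : 2 * U x ≤ 0)
  linarith

/-- Strong maximum principle for antisymmetric functions. -/
theorem fracLaplacian_antisymmetric_neg (hn : n ≠ 0) (hσ : σ ∈ Ioo (0 : ℝ) 1)
    (hν : ‖ν‖ = 1) {a : ℝ} {U : En n → ℝ} (hU : Continuous U) {B : ℝ} (hB : ∀ y, |U y| ≤ B)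
    (hanti : ∀ y, U (hyperplaneReflection x₀ ν a y) = -U y) {x : En n} {L : ℝ}
    (hL : Tendsto (fun δ : ℝ => fracLaplacianConst n σ * ∫ y in (Metric.ball x δ)ᶜ,
      (U x - U y) / ‖x - y‖ ^ ((n : ℝ) + 2 * σ)) (𝓝[>] 0) (𝓝 L))
    (hx : inner ℝ (x - x₀) ν < a) (hUx : U x = 0)
    (hmin : ∀ y, inner ℝ (y - x₀) ν < a → 0 ≤ U y)
    {z : En n} (hz : inner ℝ (z - x₀) ν < a) (hUz : 0 < U z) : L < 0 := by
  have hσ0 : 0 < σ := hσ.1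
  set α : ℝ := (n : ℝ) + 2 * σ with hα
  have hα0 : 0 < α := by positivity
  have hxz : 0 < ‖x - z‖ := by
    rw [norm_pos_iff, sub_ne_zero]
    rintro rfl
    exact hUz.ne' hUx
  have hev : ∀ᶠ y in 𝓝 z, inner ℝ (y - x₀) ν < a ∧ 0 < U y ∧ ‖x - z‖ / 2 < ‖x - y‖ := by
    have h1 : Continuous fun y : En n => inner ℝ (y - x₀) ν := by fun_prop
    have h2 : Continuous fun y : En n => ‖x - y‖ := by fun_prop
    exact ((h1.tendsto z).eventually (gt_mem_nhds hz)).and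
      (((hU.tendsto z).eventually (lt_mem_nhds hUz)).and
        ((h2.tendsto z).eventually (lt_mem_nhds (half_lt_self hxz))))
  obtain ⟨r, hr, hball⟩ := Metric.eventually_nhds_iff_ball.mp hev
  obtain ⟨hint, hle⟩ := fracLaplacian_antisymmetric_le hn hσ hν hU hB hanti hL hx hUx.le
    (fun y hy => hUx.trans_le (hmin y hy)) Metric.isOpen_ball.measurableSet
    (fun y hy => (hball y hy).1) (half_pos hxz) (fun y hy => (hball y hy).2.2.le)
  refine hle.trans_lt (mul_neg_of_pos_of_neg (fracLaplacianConst_pos hσ) ?_)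
  have hpos : ∀ y ∈ Metric.ball z r, 0 < -((U x - U y) * ((‖x - y‖ ^ α)⁻¹ -
      (‖x - hyperplaneReflection x₀ ν a y‖ ^ α)⁻¹) +
      2 * U x * (‖x - hyperplaneReflection x₀ ν a y‖ ^ α)⁻¹) := fun y hy => by
    obtain ⟨h1, h2, h3⟩ := hball y hy
    have hxy : 0 < ‖x - y‖ := (half_pos hxz).trans h3
    have h4 : (‖x - hyperplaneReflection x₀ ν a y‖ ^ α)⁻¹ < (‖x - y‖ ^ α)⁻¹ :=
      inv_strictAnti₀ (by positivity) (Real.rpow_lt_rpow hxy.le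
        (norm_sub_lt_norm_sub_hyperplaneReflection hν hx h1) hα0)
    rw [hUx]
    have := mul_pos h2 (sub_pos.mpr h4)
    linarith
  rw [← neg_pos, ← integral_neg, setIntegral_pos_iff_support_of_nonneg_ae]
  · refine (Metric.measure_ball_pos volume z hr).trans_le (measure_mono fun y hy => ⟨?_, hy⟩)
    exact Function.mem_support.mpr (hpos y hy).ne'
  · exact (ae_restrict_iff' Metric.isOpen_ball.measurableSet).mpr
      (Eventually.of_forall fun y hy => (hpos y hy).le)
  · exact hint.neg

end FractionalLaplacian

/-! ### Chains of Poisson problems closed by a fractional equation -/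

/-- Functions `w 0, …, w m` vanishing outside `Ω` with `-Δ (w i) = w (i + 1)` and
`(-Δ)^σ (w m) = f` in `Ω`. -/
structure IsNavierChain {n : ℕ} (Ω : Set (En n)) (m : ℕ) (σ : ℝ) (w : ℕ → En n → ℝ)
    (f : En n → ℝ) : Prop where
  continuous : ∀ i ≤ m, Continuous (w i)
  eq_zero : ∀ i ≤ m, ∀ x ∉ Ω, w i x = 0
  contDiffAt : ∀ i < m, ∀ x ∈ Ω, ContDiffAt ℝ 2 (w i) x
  laplacian_eq : ∀ i < m, ∀ x ∈ Ω, Laplacian.laplacian (w i) x = -w (i + 1) x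
  hasFracLaplacianAt : ∀ x ∈ Ω, HasFracLaplacianAt σ (w m) x (f x)

namespace IsNavierChain

variable {n : ℕ} {Ω : Set (En n)} {m : ℕ} {σ : ℝ} {w : ℕ → En n → ℝ} {f : En n → ℝ}

theorem exists_bound (h : IsNavierChain Ω m σ w f) (hK : IsCompact (closure Ω)) {i : ℕ}
    (hi : i ≤ m) : ∃ B : ℝ, 0 ≤ B ∧ ∀ y, |w i y| ≤ B := by
  obtain ⟨B, hB⟩ := hK.exists_bound_of_continuousOn (h.continuous i hi).continuousOn
  refine ⟨max B 0, le_max_right _ _, fun y => ?_⟩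
  by_cases hy : y ∈ Ω
  · exact (hB y (subset_closure hy)).trans (le_max_left _ _)
  · rw [h.eq_zero i hi y hy, abs_zero]
    exact le_max_right _ _

/-- A minimum over `closure Ω` of a function vanishing off `Ω` that is nonpositive somewhere in `Ω`
is attained in `Ω` and is a global minimum. -/
theorem exists_min (h : IsNavierChain Ω m σ w f) (hK : IsCompact (closure Ω)) {i : ℕ}
    (hi : i ≤ m) {x : En n} (hx : x ∈ Ω) (hwx : w i x ≤ 0) :
    ∃ z ∈ Ω, w i z ≤ 0 ∧ ∀ y, w i z ≤ w i y := by
  obtain ⟨z, hz, hzmin⟩ := hK.exists_isMinOn ⟨x, subset_closure hx⟩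
    (h.continuous i hi).continuousOn
  have hzx : w i z ≤ w i x := hzmin (subset_closure hx)
  have hglob : ∀ y, w i z ≤ w i y := fun y => by
    by_cases hy : y ∈ Ω
    · exact hzmin (subset_closure hy)
    · rw [h.eq_zero i hi y hy]
      exact hzx.trans hwx
  by_cases hzΩ : z ∈ Ω
  · exact ⟨z, hzΩ, hzx.trans hwx, hglob⟩
  -- Here the minimal value is zero, so the given `x`, where the function is nonpositive, is itself
  -- a minimizer.
  · have h0 := h.eq_zero i hi z hzΩ
    refine ⟨x, hx, hwx, fun y => ?_⟩
    linarith [hglob y]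

/-- Positivity runs from the last member down. At a nonpositive global minimum inside `Ω`, the
fractional Laplacian is nonpositive, or the Laplacian is nonnegative; either contradicts a positive
right side. -/
theorem pos (h : IsNavierChain Ω m σ w f) (hK : IsCompact (closure Ω)) (hσ : σ ∈ Ioo (0 : ℝ) 1)
    (hf : ∀ x ∈ Ω, 0 < f x) {i : ℕ} (hi : i ≤ m) : ∀ x ∈ Ω, 0 < w i x := by
  induction hi using Nat.decreasingInduction with
  | self =>
    intro x hx
    by_contra! hneg
    obtain ⟨z, hz, -, hmin⟩ := h.exists_min hK le_rfl hx hneg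
    exact absurd ((h.hasFracLaplacianAt z hz).nonpos_of_forall_le hσ hmin) (not_le.mpr (hf z hz))
  | of_succ k hk ih =>
    intro x hx
    by_contra! hneg
    obtain ⟨z, hz, -, hmin⟩ := h.exists_min hK hk.le hx hneg
    have h1 := IsLocalMin.laplacian_nonneg (Eventually.of_forall hmin) (h.contDiffAt k hk z hz)
    rw [h.laplacian_eq k hk z hz] at h1
    linarith [ih z hz]

theorem nonneg (h : IsNavierChain Ω m σ w f) (hpos : ∀ i ≤ m, ∀ x ∈ Ω, 0 < w i x) {i : ℕ}
    (hi : i ≤ m) (x : En n) : 0 ≤ w i x := by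
  by_cases hx : x ∈ Ω
  · exact (hpos i hi x hx).le
  · exact (h.eq_zero i hi x hx).ge

variable {x₀ ν : En n} {a : ℝ}

/-- The Laplacian of the difference of a member of a chain and its reflection. -/
theorem laplacian_reflection_sub (h : IsNavierChain Ω m σ w f) (hν : ‖ν‖ = 1) {i : ℕ}
    (hi : i < m) {x : En n} (hx : x ∈ Ω) (hRx : hyperplaneReflection x₀ ν a x ∈ Ω) :
    ContDiffAt ℝ 2 (fun y => w i (hyperplaneReflection x₀ ν a y) - w i y) x ∧
      Laplacian.laplacian (fun y => w i (hyperplaneReflection x₀ ν a y) - w i y) x =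
        -(w (i + 1) (hyperplaneReflection x₀ ν a x) - w (i + 1) x) := by
  have h1 : ContDiffAt ℝ 2 (fun y => w i (hyperplaneReflection x₀ ν a y)) x :=
    ContDiffAt.comp x (h.contDiffAt i hi _ hRx) (contDiff_hyperplaneReflection a).contDiffAt
  have h2 := h.contDiffAt i hi x hx
  refine ⟨h1.sub h2, ?_⟩
  have h3 := h1.laplacian_sub h2
  have h4 := laplacian_comp_hyperplaneReflection hν a (h.contDiffAt i hi _ hRx)
  rw [h.laplacian_eq i hi _ hRx] at h4
  rw [h4, h.laplacian_eq i hi x hx] at h3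
  refine h3.trans ?_
  ring

theorem continuous_reflection_sub (h : IsNavierChain Ω m σ w f) {i : ℕ} (hi : i ≤ m) :
    Continuous fun y => w i (hyperplaneReflection x₀ ν a y) - w i y :=
  ((h.continuous i hi).comp (continuous_hyperplaneReflection a)).sub (h.continuous i hi)

theorem isCompact_cap (hK : IsCompact (closure Ω)) :
    IsCompact {x ∈ closure Ω | inner ℝ (x - x₀) ν ≤ a} :=
  hK.inter_right (t := {x | inner ℝ (x - x₀) ν ≤ a}) (isClosed_le (by fun_prop) continuous_const)

/-- Maximum principle in a slab for the differences: a lower bound for `w (i + 1)` passes to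
`w i`. -/
theorem reflection_sub_ge_of_succ (h : IsNavierChain Ω m σ w f) (hK : IsCompact (closure Ω))
    (hΩ : IsOpen Ω) (hν : ‖ν‖ = 1) (hpos : ∀ i ≤ m, ∀ x ∈ Ω, 0 < w i x)
    (hcap : ∀ x ∈ closure Ω, inner ℝ (x - x₀) ν < a → hyperplaneReflection x₀ ν a x ∈ Ω)
    {l : ℝ} (hl1 : l ≤ 1) {i : ℕ} (hi : i < m)
    (hfar : ∀ x ∈ closure Ω, inner ℝ (x - x₀) ν ≤ a - l →
      0 ≤ w i (hyperplaneReflection x₀ ν a x) - w i x)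
    {M : ℝ} (hM : 0 ≤ M)
    (hsucc : ∀ x ∈ closure Ω, inner ℝ (x - x₀) ν ≤ a →
      -M ≤ w (i + 1) (hyperplaneReflection x₀ ν a x) - w (i + 1) x) :
    ∀ x ∈ closure Ω, inner ℝ (x - x₀) ν ≤ a →
      -M ≤ w i (hyperplaneReflection x₀ ν a x) - w i x := by
  set U : En n → ℝ := fun y => w i (hyperplaneReflection x₀ ν a y) - w i y with hU
  have hUc : Continuous U := h.continuous_reflection_sub hi.le
  intro x hx hxa
  -- A constant strictly above `M` turns the final comparison of Laplacians into a strict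
  -- contradiction.
  suffices hkey : ∀ N, M < N → -N ≤ U x by
    by_contra! hlt
    have hlt : U x < -M := hlt
    linarith [hkey ((M - U x) / 2) (by linarith)]
  intro N hM'
  by_cases hxl : inner ℝ (x - x₀) ν ≤ a - l
  · exact le_trans (by linarith) (hfar x hx hxl)
  push Not at hxl
  -- The barrier has Laplacian `2` and lies between `0` and `1` on the slab because `l ≤ 1`. At an
  -- interior minimum of `U - (N / 2) q` one gets `0 ≤ -U (i + 1) - N`, incompatible with `-M ≤ U (i
  -- + 1)`. If that minimum is below `-N`, then `U` is negative there, which rules out the boundary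
  -- of the slab.
  set q : En n → ℝ := fun y => (inner ℝ y ν - (inner ℝ x₀ ν + a)) ^ 2 with hq
  have hqe : ∀ y, q y = (inner ℝ (y - x₀) ν - a) ^ 2 := fun y => by
    simp only [hq, inner_sub_left]
    ring
  have hqc : ContDiff ℝ 2 q :=
    ((contDiff_id.inner ℝ contDiff_const).sub contDiff_const).pow 2
  set g : En n → ℝ := fun y => U y - (N / 2) • q y with hg
  have hgc : Continuous g := hUc.sub (hqc.continuous.const_smul (N / 2))
  obtain ⟨z, hz, hzmin⟩ := ((isCompact_cap (x₀ := x₀) (ν := ν) (a := a) hK).inter_right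
    (isClosed_le continuous_const (by fun_prop) :
      IsClosed {y : En n | a - l ≤ inner ℝ (y - x₀) ν})).exists_isMinOn
    ⟨x, ⟨hx, hxa⟩, hxl.le⟩ hgc.continuousOn
  obtain ⟨⟨hzc, hza⟩, hzl⟩ := hz
  have hza : inner ℝ (z - x₀) ν ≤ a := hza
  have hzl : a - l ≤ inner ℝ (z - x₀) ν := hzl
  have hN0 : 0 < N := hM.trans_lt hM'
  have hq1 : ∀ y, a - l ≤ inner ℝ (y - x₀) ν → inner ℝ (y - x₀) ν ≤ a → q y ≤ 1 := by
    intro y h1 h2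
    rw [hqe]
    nlinarith
  have hq0 : ∀ y, 0 ≤ q y := fun y => sq_nonneg _
  have hgz : g z ≤ g x := hzmin ⟨⟨hx, hxa⟩, hxl.le⟩
  have hgzU : -N ≤ g z → -N ≤ U x := fun hgz' => by
    have h1 := hq0 x
    have h2 : (0 : ℝ) ≤ (N / 2) • q x := by rw [smul_eq_mul]; positivity
    simp only [hg] at hgz hgz'
    linarith
  apply hgzU
  by_contra! hlt
  have hqz : (N / 2) • q z ≤ N / 2 := by
    rw [smul_eq_mul]
    nlinarith [hq1 z hzl hza]
  have hUz : U z < 0 := by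
    simp only [hg] at hlt
    linarith
  have hza' : inner ℝ (z - x₀) ν < a := by
    refine lt_of_le_of_ne hza fun he => ?_
    simp only [hU, hyperplaneReflection_of_inner_eq he, sub_self] at hUz
    exact lt_irrefl _ hUz
  have hzl' : a - l < inner ℝ (z - x₀) ν := by
    by_contra! hle
    exact absurd (hfar z hzc hle) (not_le.mpr hUz)
  have hzΩ : z ∈ Ω := by
    by_contra hzΩ
    simp only [hU, h.eq_zero i hi.le z hzΩ, sub_zero] at hUz
    exact absurd (h.nonneg hpos hi.le _) (not_le.mpr hUz)
  have hloc : IsLocalMin g z := by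
    have hc : Continuous fun y : En n => inner ℝ (y - x₀) ν := by fun_prop
    filter_upwards [hΩ.mem_nhds hzΩ, (hc.tendsto z).eventually (gt_mem_nhds hza'),
      (hc.tendsto z).eventually (lt_mem_nhds hzl')] with y h1 h2 h3
    exact hzmin ⟨⟨subset_closure h1, h2.le⟩, h3.le⟩
  obtain ⟨hUd, hUl⟩ := h.laplacian_reflection_sub hν hi hzΩ (hcap z hzc hza')
  have hqs : ContDiffAt ℝ 2 ((N / 2) • q) z := (hqc.const_smul (N / 2)).contDiffAt
  have hlap := hloc.laplacian_nonneg (hUd.sub hqs)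
  have hlap2 : Laplacian.laplacian g z = _ := hUd.laplacian_sub hqs
  have hlap3 : Laplacian.laplacian (fun y => (N / 2) • q y) z = (N / 2) • Laplacian.laplacian q z :=
    InnerProductSpace.laplacian_smul (N / 2) hqc.contDiffAt
  rw [hlap2, hUl, hlap3, smul_eq_mul, laplacian_sq_inner_sub, hν] at hlap
  linarith [hsucc z hzc hza]

/-- A lower bound for the difference of the last member of a chain and its reflection passes to all
members. -/
theorem reflection_sub_ge (h : IsNavierChain Ω m σ w f) (hK : IsCompact (closure Ω))
    (hΩ : IsOpen Ω) (hν : ‖ν‖ = 1) (hpos : ∀ i ≤ m, ∀ x ∈ Ω, 0 < w i x)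
    (hcap : ∀ x ∈ closure Ω, inner ℝ (x - x₀) ν < a → hyperplaneReflection x₀ ν a x ∈ Ω)
    {l : ℝ} (hl1 : l ≤ 1)
    (hfar : ∀ i ≤ m, ∀ x ∈ closure Ω, inner ℝ (x - x₀) ν ≤ a - l →
      0 ≤ w i (hyperplaneReflection x₀ ν a x) - w i x)
    {M : ℝ} (hM : 0 ≤ M)
    (hlast : ∀ x ∈ closure Ω, inner ℝ (x - x₀) ν ≤ a →
      -M ≤ w m (hyperplaneReflection x₀ ν a x) - w m x) {i : ℕ} (hi : i ≤ m) :
    ∀ x ∈ closure Ω, inner ℝ (x - x₀) ν ≤ a →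
      -M ≤ w i (hyperplaneReflection x₀ ν a x) - w i x := by
  induction hi using Nat.decreasingInduction with
  | self => exact hlast
  | of_succ k hk ih =>
    exact h.reflection_sub_ge_of_succ hK hΩ hν hpos hcap hl1 hk (hfar k hk.le) hM ih

theorem tendsto_fracLaplacian_reflection_sub (h : IsNavierChain Ω m σ w f)
    (hK : IsCompact (closure Ω)) (hσ : σ ∈ Ioo (0 : ℝ) 1) (hν : ‖ν‖ = 1) {x : En n} (hx : x ∈ Ω)
    (hRx : hyperplaneReflection x₀ ν a x ∈ Ω) :
    Tendsto (fun δ : ℝ => fracLaplacianConst n σ * ∫ y in (Metric.ball x δ)ᶜ,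
      ((w m (hyperplaneReflection x₀ ν a x) - w m x) -
        (w m (hyperplaneReflection x₀ ν a y) - w m y)) / ‖x - y‖ ^ ((n : ℝ) + 2 * σ)) (𝓝[>] 0)
      (𝓝 (f (hyperplaneReflection x₀ ν a x) - f x)) := by
  obtain ⟨B, -, hB⟩ := h.exists_bound hK le_rfl
  exact HasFracLaplacianAt.tendsto_reflection_sub hσ.1 hν (h.continuous m le_rfl) hB
    (h.hasFracLaplacianAt x hx) (h.hasFracLaplacianAt _ hRx)

theorem exists_reflection_sub_bound (h : IsNavierChain Ω m σ w f) (hK : IsCompact (closure Ω)) :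
    ∃ B : ℝ, ∀ y, |w m (hyperplaneReflection x₀ ν a y) - w m y| ≤ B := by
  obtain ⟨B, -, hB⟩ := h.exists_bound hK le_rfl
  exact ⟨B + B, fun y => (abs_sub _ _).trans (add_le_add (hB _) (hB _))⟩

/-- Narrow region principle for the last member of a chain. -/
theorem reflection_sub_last_ge (h : IsNavierChain Ω m σ w f) (hK : IsCompact (closure Ω))
    (hn : n ≠ 0) (hσ : σ ∈ Ioo (0 : ℝ) 1) (hν : ‖ν‖ = 1) (hpos : ∀ i ≤ m, ∀ x ∈ Ω, 0 < w i x)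
    (hcap : ∀ x ∈ closure Ω, inner ℝ (x - x₀) ν < a → hyperplaneReflection x₀ ν a x ∈ Ω)
    {l : ℝ} (hl : 0 < l)
    (hfar : ∀ x ∈ closure Ω, inner ℝ (x - x₀) ν ≤ a - l →
      0 ≤ w m (hyperplaneReflection x₀ ν a x) - w m x)
    {N k : ℝ} (hN : 0 ≤ N) (hk : 0 < k)
    (hkl : k ≤ fracLaplacianConst n σ * (2 * ((5 * l) ^ ((n : ℝ) + 2 * σ))⁻¹ *
      (l ^ n * volume.real (Metric.ball (0 : En n) 1))))
    (hf : ∀ x ∈ Ω, inner ℝ (x - x₀) ν < a → -N ≤ f (hyperplaneReflection x₀ ν a x) - f x) :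
    ∀ x ∈ closure Ω, inner ℝ (x - x₀) ν ≤ a →
      -(N / k) ≤ w m (hyperplaneReflection x₀ ν a x) - w m x := by
  set U : En n → ℝ := fun y => w m (hyperplaneReflection x₀ ν a y) - w m y with hU
  have hUc : Continuous U := h.continuous_reflection_sub le_rfl
  intro x hx hxa
  change -(N / k) ≤ U x
  obtain ⟨z, hz, hzmin⟩ := (isCompact_cap (x₀ := x₀) (ν := ν) (a := a) hK).exists_isMinOn
    ⟨x, hx, hxa⟩ hUc.continuousOn
  obtain ⟨hzc, hza⟩ := hz
  have hza : inner ℝ (z - x₀) ν ≤ a := hza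
  refine le_trans ?_ (hzmin ⟨hx, hxa⟩ : U z ≤ U x)
  by_contra! hlt
  have hUz : U z < 0 := hlt.trans_le (neg_nonpos.mpr (by positivity))
  have hza' : inner ℝ (z - x₀) ν < a := by
    refine lt_of_le_of_ne hza fun he => ?_
    simp only [hU, hyperplaneReflection_of_inner_eq he, sub_self] at hUz
    exact lt_irrefl _ hUz
  have hzl' : a - l < inner ℝ (z - x₀) ν := by
    by_contra! hle
    exact absurd (hfar z hzc hle) (not_le.mpr hUz)
  have hzΩ : z ∈ Ω := by
    by_contra hzΩ
    simp only [hU, h.eq_zero m le_rfl z hzΩ, sub_zero] at hUz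
    exact absurd (h.nonneg hpos le_rfl _) (not_le.mpr hUz)
  have hglob : ∀ y, inner ℝ (y - x₀) ν < a → U z ≤ U y := fun y hy => by
    by_cases hyc : y ∈ closure Ω
    · exact hzmin ⟨hyc, hy.le⟩
    · have h0 := h.eq_zero m le_rfl y fun hyΩ => hyc (subset_closure hyΩ)
      simp only [hU, h0, sub_zero] at hUz ⊢
      exact hUz.le.trans (h.nonneg hpos le_rfl _)
  obtain ⟨B, hB⟩ := h.exists_reflection_sub_bound (x₀ := x₀) (ν := ν) (a := a) hK
  -- At `z` the fractional Laplacian of `U` is at most `k * U z`, which is below `-N`, while the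
  -- equation bounds it below by `-N`.
  have hL := fracLaplacian_antisymmetric_le_of_near hn hσ hν hUc hB
    (fun y => by simp only [hU, hyperplaneReflection_hyperplaneReflection hν]; ring)
    (h.tendsto_fracLaplacian_reflection_sub hK hσ hν hzΩ (hcap z hzc hza')) hza' hUz.le hglob hl
    hzl'.le
  have h1 := hf z hzΩ hza'
  have h2 := mul_le_mul_of_nonpos_right hkl hUz.le
  have h3 : U z * k < -N := by
    have := mul_lt_mul_of_pos_right hlt hk
    rwa [neg_mul, div_mul_cancel₀ _ hk.ne'] at this
  have h4 : fracLaplacianConst n σ * (2 * U z * ((5 * l) ^ ((n : ℝ) + 2 * σ))⁻¹ *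
      (l ^ n * volume.real (Metric.ball (0 : En n) 1))) = fracLaplacianConst n σ *
      (2 * ((5 * l) ^ ((n : ℝ) + 2 * σ))⁻¹ *
      (l ^ n * volume.real (Metric.ball (0 : En n) 1))) * U z := by ring
  rw [h4] at hL
  linarith

/-- Strong maximum principle for the differences of a chain and its reflection. -/
theorem reflection_sub_pos (h : IsNavierChain Ω m σ w f) (hK : IsCompact (closure Ω))
    (hΩ : IsOpen Ω) (hn : n ≠ 0) (hσ : σ ∈ Ioo (0 : ℝ) 1) (hν : ‖ν‖ = 1)
    (hpos : ∀ i ≤ m, ∀ x ∈ Ω, 0 < w i x) (hx₀ : x₀ ∈ frontier Ω) (ha : 0 < a)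
    (hcap : ∀ x ∈ closure Ω, inner ℝ (x - x₀) ν < a → hyperplaneReflection x₀ ν a x ∈ Ω)
    (hnonneg : ∀ i ≤ m, ∀ x ∈ closure Ω, inner ℝ (x - x₀) ν ≤ a →
      0 ≤ w i (hyperplaneReflection x₀ ν a x) - w i x)
    (hf : ∀ x ∈ Ω, inner ℝ (x - x₀) ν < a → f x ≤ f (hyperplaneReflection x₀ ν a x))
    {i : ℕ} (hi : i ≤ m) :
    ∀ x ∈ closure Ω, inner ℝ (x - x₀) ν < a →
      0 < w i (hyperplaneReflection x₀ ν a x) - w i x := by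
  have hbdry : ∀ i ≤ m, ∀ x ∈ closure Ω, x ∉ Ω → inner ℝ (x - x₀) ν < a →
      0 < w i (hyperplaneReflection x₀ ν a x) - w i x := fun i hi x hx hxΩ hxa => by
    rw [h.eq_zero i hi x hxΩ, sub_zero]
    exact hpos i hi _ (hcap x hx hxa)
  induction hi using Nat.decreasingInduction with
  | self =>
    intro x hx hxa
    by_cases hxΩ : x ∈ Ω
    · refine lt_of_le_of_ne (hnonneg m le_rfl x hx hxa.le) fun h0 => ?_
      obtain ⟨B, hB⟩ := h.exists_reflection_sub_bound (x₀ := x₀) (ν := ν) (a := a) hK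
      -- The point `x₀` witnesses that the difference is not identically zero: the function vanishes
      -- there, and its mirror image lies in `Ω`.
      have hx₀a : inner ℝ (x₀ - x₀) ν < a := by simpa using ha
      have hx₀Ω : x₀ ∉ Ω := by
        rw [hΩ.frontier_eq] at hx₀
        exact hx₀.2
      have hneg := fracLaplacian_antisymmetric_neg hn hσ hν
        (h.continuous_reflection_sub (x₀ := x₀) (ν := ν) (a := a) le_rfl) hB
        (fun y => by simp only [hyperplaneReflection_hyperplaneReflection hν]; ring)
        (h.tendsto_fracLaplacian_reflection_sub hK hσ hν hxΩ (hcap x hx hxa)) hxa h0.symm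
        (fun y hy => by
          by_cases hyc : y ∈ closure Ω
          · exact hnonneg m le_rfl y hyc hy.le
          · rw [h.eq_zero m le_rfl y fun hyΩ => hyc (subset_closure hyΩ), sub_zero]
            exact h.nonneg hpos le_rfl _)
        hx₀a (hbdry m le_rfl x₀ (frontier_subset_closure hx₀) hx₀Ω hx₀a)
      linarith [hf x hxΩ hxa]
    · exact hbdry m le_rfl x hx hxΩ hxa
  | of_succ k hk ih =>
    intro x hx hxa
    by_cases hxΩ : x ∈ Ω
    · refine lt_of_le_of_ne (hnonneg k hk.le x hx hxa.le) fun h0 => ?_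
      -- An interior zero of the difference is a local minimum, but its Laplacian there is minus the
      -- next difference, already known to be positive.
      obtain ⟨hUd, hUl⟩ := h.laplacian_reflection_sub hν hk hxΩ (hcap x hx hxa)
      have hloc : IsLocalMin (fun y => w k (hyperplaneReflection x₀ ν a y) - w k y) x := by
        have hc : Continuous fun y : En n => inner ℝ (y - x₀) ν := by fun_prop
        filter_upwards [hΩ.mem_nhds hxΩ, (hc.tendsto x).eventually (gt_mem_nhds hxa)] with y h1 h2
        rw [← h0]
        exact hnonneg k hk.le y (subset_closure h1) h2.le
      have hlap := hloc.laplacian_nonneg hUd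
      rw [hUl] at hlap
      linarith [ih x hx hxa]
    · exact hbdry k hk.le x hx hxΩ hxa

end IsNavierChain

/-! ### The chains of a solution -/

section Chains

variable {n : ℕ} {Ω : Set (En n)}

theorem contDiffOn_iterate_neg_laplacianWithin {s : Set (En n)} (hs : UniqueDiffOn ℝ s) {m i : ℕ}
    (hi : i ≤ m) {u : En n → ℝ} (hu : ContDiffOn ℝ ((2 * m : ℕ) : WithTop ℕ∞) u s) :
    ContDiffOn ℝ ((2 * (m - i) : ℕ) : WithTop ℕ∞) ((fun (f : En n → ℝ) (y : En n) =>
      -InnerProductSpace.laplacianWithin f s y)^[i] u) s := by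
  induction i with
  | zero => simpa using hu
  | succ k ih =>
    rw [Function.iterate_succ_apply']
    refine ((ih (by omega)).laplacianWithin hs ?_).neg
    have : 2 * (m - (k + 1)) + 2 = 2 * (m - k) := by omega
    exact_mod_cast this.le

theorem iterNegLaplacian_zero (u : En n → ℝ) : iterNegLaplacian Ω 0 u = u := by
  funext x
  simp [iterNegLaplacian]

theorem iterNegLaplacian_of_mem_closure (i : ℕ) (u : En n → ℝ) {x : En n} (hx : x ∈ closure Ω) :
    iterNegLaplacian Ω i u x = ((fun (f : En n → ℝ) (y : En n) =>
      -InnerProductSpace.laplacianWithin f (closure Ω) y)^[i] u) x := by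
  rw [iterNegLaplacian, if_pos hx]

/-- Inside `Ω` the derivatives within the closure are the ordinary ones. Global continuity comes
from gluing along the two closed sets `closure Ω` and `Ωᶜ`, on both of which the function is
continuous. -/
theorem IsSmoothStrictlyConvexDomain.isNavierChain (hΩ : IsSmoothStrictlyConvexDomain Ω) {m : ℕ}
    {σ : ℝ} {u f : En n → ℝ} (hu : ContDiffOn ℝ ((2 * m : ℕ) : WithTop ℕ∞) u (closure Ω))
    (h0 : ∀ i ≤ m, ∀ x ∉ Ω, iterNegLaplacian Ω i u x = 0)
    (hf : ∀ x ∈ Ω, HasFracLaplacianAt σ (iterNegLaplacian Ω m u) x (f x)) :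
    IsNavierChain Ω m σ (fun i => iterNegLaplacian Ω i u) f := by
  have hud := hΩ.uniqueDiffOn_closure
  set F : ℕ → En n → ℝ := fun i => (fun (f : En n → ℝ) (y : En n) =>
    -InnerProductSpace.laplacianWithin f (closure Ω) y)^[i] u with hF
  have hFd : ∀ i ≤ m, ContDiffOn ℝ ((2 * (m - i) : ℕ) : WithTop ℕ∞) (F i) (closure Ω) :=
    fun i hi => contDiffOn_iterate_neg_laplacianWithin hud hi hu
  have heq : ∀ i, ∀ x ∈ closure Ω, iterNegLaplacian Ω i u x = F i x := fun i x hx =>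
    iterNegLaplacian_of_mem_closure i u hx
  have hnhds : ∀ x ∈ Ω, closure Ω ∈ 𝓝 x := fun x hx =>
    mem_of_superset (hΩ.isOpen.mem_nhds hx) subset_closure
  have hev : ∀ i, ∀ x ∈ Ω, iterNegLaplacian Ω i u =ᶠ[𝓝 x] F i := fun i x hx => by
    filter_upwards [hnhds x hx] with y hy
    exact heq i y hy
  refine ⟨fun i hi => ?_, h0, fun i hi x hx => ?_, fun i hi x hx => ?_, hf⟩
  · have h1 : ContinuousOn (iterNegLaplacian Ω i u) (closure Ω) :=
      (hFd i hi).continuousOn.congr (heq i)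
    have h2 : ContinuousOn (iterNegLaplacian Ω i u) Ωᶜ :=
      (continuousOn_const (c := (0 : ℝ))).congr fun x hx => h0 i hi x hx
    have h3 := h1.union_of_isClosed h2 isClosed_closure hΩ.isOpen.isClosed_compl
    rw [← continuousOn_univ]
    refine h3.mono fun x _ => ?_
    by_cases hx : x ∈ Ω
    · exact Or.inl (subset_closure hx)
    · exact Or.inr hx
  · refine ContDiffAt.congr_of_eventuallyEq ?_ (hev i x hx)
    refine ((hFd i hi.le).contDiffAt (hnhds x hx)).of_le ?_
    have : 2 ≤ 2 * (m - i) := by omega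
    exact_mod_cast this
  · have h1 := (InnerProductSpace.laplacian_congr_nhds (hev i x hx)).eq_of_nhds
    have h2 : F (i + 1) x = -InnerProductSpace.laplacianWithin (F i) (closure Ω) x := by
      simp only [hF, Function.iterate_succ_apply']
    rw [laplacianWithin_eq_laplacian_of_mem_interior hud (by rwa [hΩ.interior_closure])] at h2
    change Laplacian.laplacian (iterNegLaplacian Ω i u) x = -iterNegLaplacian Ω (i + 1) u x
    rw [h1, heq (i + 1) x (subset_closure hx), h2, neg_neg]

end Chains

/-! ### Moving planes -/

section MovingPlanes

/-- By Bernoulli's inequality the power lies above its tangent at `t`, so only `t` needs an upper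
bound. This one-sided Lipschitz estimate is where `1 ≤ p` enters. -/
theorem exists_rpow_sub_rpow_ge {p B : ℝ} (hp : 1 ≤ p) (hB : 0 ≤ B) :
    ∃ C : ℝ, 0 ≤ C ∧ ∀ s t N : ℝ, 0 ≤ s → 0 ≤ t → t ≤ B → 0 ≤ N → -N ≤ s - t →
      -(C * N) ≤ s ^ p - t ^ p := by
  refine ⟨p * B ^ (p - 1), by positivity, fun s t N hs ht htB hN hst => ?_⟩
  rcases le_or_gt t s with hle | hlt
  · have h1 := Real.rpow_le_rpow ht hle (by linarith : 0 ≤ p)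
    have h2 : 0 ≤ p * B ^ (p - 1) * N := by positivity
    linarith
  · have ht0 : 0 < t := hs.trans_lt hlt
    have h1 := one_add_mul_self_le_rpow_one_add (s := s / t - 1)
      (by linarith [div_nonneg hs ht]) hp
    rw [add_sub_cancel, Real.div_rpow hs ht, le_div_iff₀ (by positivity)] at h1
    have h2 : t ^ p = t ^ (p - 1) * t := by
      rw [← Real.rpow_add_one ht0.ne', sub_add_cancel]
    have h3 : (1 + p * (s / t - 1)) * t ^ p = t ^ p + p * t ^ (p - 1) * (s - t) := by
      rw [h2]
      field_simp
    have h4 : t ^ (p - 1) ≤ B ^ (p - 1) := Real.rpow_le_rpow ht htB (by linarith)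
    have h5 : p * t ^ (p - 1) * (t - s) ≤ p * B ^ (p - 1) * N :=
      mul_le_mul (mul_le_mul_of_nonneg_left h4 (by linarith)) (by linarith) (by linarith)
        (by positivity)
    nlinarith

/-- The right side is a positive multiple of `l ^ (-2σ)`, so thin slabs beat any prescribed
constant. -/
theorem eventually_le_narrow_constant {n : ℕ} {σ : ℝ} (hσ : σ ∈ Ioo (0 : ℝ) 1) (k : ℝ) :
    ∀ᶠ l : ℝ in 𝓝[>] 0, k ≤ fracLaplacianConst n σ * (2 * ((5 * l) ^ ((n : ℝ) + 2 * σ))⁻¹ *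
      (l ^ n * volume.real (Metric.ball (0 : En n) 1))) := by
  have hC := fracLaplacianConst_pos (n := n) hσ
  have hσ0 : 0 < σ := hσ.1
  have hω : 0 < volume.real (Metric.ball (0 : En n) 1) :=
    ENNReal.toReal_pos (Metric.measure_ball_pos volume _ one_pos).ne' measure_ball_lt_top.ne
  set c : ℝ := fracLaplacianConst n σ * 2 * (5 ^ ((n : ℝ) + 2 * σ))⁻¹ *
    volume.real (Metric.ball (0 : En n) 1) with hc
  have hc0 : 0 < c := by positivity
  have ht : Tendsto (fun l : ℝ => c * l ^ (-(2 * σ))) (𝓝[>] 0) atTop :=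
    (tendsto_rpow_neg_nhdsGT_zero (by linarith)).const_mul_atTop hc0
  filter_upwards [ht.eventually_ge_atTop k, self_mem_nhdsWithin] with l hl hl0
  have hl0 : 0 < l := hl0
  refine hl.trans (le_of_eq ?_)
  rw [Real.mul_rpow (by norm_num) hl0.le, Real.rpow_add hl0, Real.rpow_natCast,
    Real.rpow_neg hl0.le, hc]
  field_simp

variable {n : ℕ} {Ω : Set (En n)} {x₀ ν : En n}

/-- One half of the narrow region principle for a coupled system: a lower bound for the differences
of one chain implies half of that bound for the other chain. -/
theorem IsNavierChain.reflection_sub_ge_half {m m' : ℕ} {σ σ' p a l B C : ℝ}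
    {w z : ℕ → En n → ℝ} {f : En n → ℝ} (hw : IsNavierChain Ω m σ w fun x => z 0 x ^ p)
    (hz : IsNavierChain Ω m' σ' z f) (hK : IsCompact (closure Ω)) (hΩ : IsOpen Ω) (hn : n ≠ 0)
    (hσ : σ ∈ Ioo (0 : ℝ) 1) (hν : ‖ν‖ = 1)
    (hwpos : ∀ i ≤ m, ∀ x ∈ Ω, 0 < w i x) (hzpos : ∀ i ≤ m', ∀ x ∈ Ω, 0 < z i x)
    (hzB : ∀ x, |z 0 x| ≤ B) (hC0 : 0 ≤ C)
    (hC : ∀ s t N : ℝ, 0 ≤ s → 0 ≤ t → t ≤ B → 0 ≤ N → -N ≤ s - t → -(C * N) ≤ s ^ p - t ^ p)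
    (hcap : ∀ x ∈ closure Ω, inner ℝ (x - x₀) ν < a → hyperplaneReflection x₀ ν a x ∈ Ω)
    (hl : 0 < l) (hl1 : l ≤ 1)
    (hCl : 2 * C + 1 ≤ fracLaplacianConst n σ * (2 * ((5 * l) ^ ((n : ℝ) + 2 * σ))⁻¹ *
      (l ^ n * volume.real (Metric.ball (0 : En n) 1))))
    (hwfar : ∀ i ≤ m, ∀ x ∈ closure Ω, inner ℝ (x - x₀) ν ≤ a - l →
      0 ≤ w i (hyperplaneReflection x₀ ν a x) - w i x)
    (hzfar : ∀ i ≤ m', ∀ x ∈ closure Ω, inner ℝ (x - x₀) ν ≤ a - l →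
      0 ≤ z i (hyperplaneReflection x₀ ν a x) - z i x)
    {M : ℝ} (hM : 0 ≤ M)
    (hzM : ∀ x ∈ closure Ω, inner ℝ (x - x₀) ν ≤ a →
      -M ≤ z m' (hyperplaneReflection x₀ ν a x) - z m' x) :
    ∀ x ∈ closure Ω, inner ℝ (x - x₀) ν ≤ a →
      -(M / 2) ≤ w m (hyperplaneReflection x₀ ν a x) - w m x := by
  have hz0 := hz.reflection_sub_ge hK hΩ hν hzpos hcap hl1 hzfar hM hzM (Nat.zero_le _)
  intro x hx hxa
  -- The equation has defect at most `C * M`, and `C * M / (2 * C + 1) ≤ M / 2`. The summand `1`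
  -- keeps the divisor positive when `C = 0`.
  refine le_trans ?_ (hw.reflection_sub_last_ge hK hn hσ hν hwpos hcap hl (hwfar m le_rfl)
    (mul_nonneg hC0 hM) (by linarith : 0 < 2 * C + 1) hCl (fun y hy hya => ?_) x hx hxa)
  · rw [neg_le_neg_iff, div_le_div_iff₀ (by linarith) (by norm_num)]
    nlinarith
  · exact hC _ _ M (hz.nonneg hzpos (Nat.zero_le _) _) (hz.nonneg hzpos (Nat.zero_le _) _)
      ((le_abs_self _).trans (hzB y)) hM (hz0 y (subset_closure hy) hya.le)

/-- The differences of a chain and its reflections in the planes of height `a` are nonnegative on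
the cap of height `a`. -/
def CapNonneg (Ω : Set (En n)) (x₀ ν : En n) (m : ℕ) (w : ℕ → En n → ℝ) (a : ℝ) : Prop :=
  ∀ i ≤ m, ∀ x ∈ closure Ω, inner ℝ (x - x₀) ν ≤ a →
    0 ≤ w i (hyperplaneReflection x₀ ν a x) - w i x

/-- On the plane the difference vanishes, so for each point the strict condition `⟪x - x₀, ν⟫ < a`
may replace the weak one. The condition then becomes a union of two closed sets of heights. -/
theorem isClosed_capNonneg {m : ℕ} {w : ℕ → En n → ℝ} (hw : ∀ i ≤ m, Continuous (w i)) :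
    IsClosed {a : ℝ | CapNonneg Ω x₀ ν m w a} := by
  have heq : {a : ℝ | CapNonneg Ω x₀ ν m w a} = ⋂ i, ⋂ (_ : i ≤ m), ⋂ x, ⋂ (_ : x ∈ closure Ω),
      ({a : ℝ | a ≤ inner ℝ (x - x₀) ν} ∪
        {a : ℝ | 0 ≤ w i (hyperplaneReflection x₀ ν a x) - w i x}) := by
    ext a
    simp only [CapNonneg, mem_ofPred_eq, mem_iInter, mem_union]
    refine forall₄_congr fun i _ x _ => ⟨fun h => ?_, fun h hxa => ?_⟩
    · rcases le_or_gt a (inner ℝ (x - x₀) ν) with h1 | h1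
      · exact Or.inl h1
      · exact Or.inr (h h1.le)
    · rcases h with h | h
      · rw [hyperplaneReflection_of_inner_eq (le_antisymm hxa h), sub_self]
      · exact h
  rw [heq]
  refine isClosed_iInter fun i => isClosed_iInter fun hi => isClosed_iInter fun x =>
    isClosed_iInter fun _ => (isClosed_le continuous_id continuous_const).union
      (isClosed_le continuous_const ?_)
  have h1 : Continuous fun a : ℝ => hyperplaneReflection x₀ ν a x :=
    continuous_hyperplaneReflection_uncurry.comp (Continuous.prodMk_left x)
  exact ((hw i hi).comp h1).sub continuous_const

/-- Strict positivity of the differences is stable under small changes of the plane, away from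
it. -/
theorem eventually_reflection_sub_nonneg (hK : IsCompact (closure Ω)) {m : ℕ} {w : ℕ → En n → ℝ}
    (hw : ∀ i ≤ m, Continuous (w i)) {a b : ℝ}
    (hpos : ∀ i ≤ m, ∀ x ∈ closure Ω, inner ℝ (x - x₀) ν ≤ b →
      0 < w i (hyperplaneReflection x₀ ν a x) - w i x) :
    ∀ᶠ a' in 𝓝 a, ∀ i ≤ m, ∀ x ∈ closure Ω, inner ℝ (x - x₀) ν ≤ b →
      0 ≤ w i (hyperplaneReflection x₀ ν a' x) - w i x := by
  have h : ∀ i ∈ Iic m, ∀ᶠ a' in 𝓝 a, ∀ x ∈ {x ∈ closure Ω | inner ℝ (x - x₀) ν ≤ b},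
      0 < w i (hyperplaneReflection x₀ ν a' x) - w i x := fun i hi => by
    refine (IsNavierChain.isCompact_cap hK).eventually_forall_of_forall_eventually fun x hx => ?_
    have hc : Continuous fun q : ℝ × En n =>
        w i (hyperplaneReflection x₀ ν q.1 q.2) - w i q.2 :=
      ((hw i hi).comp continuous_hyperplaneReflection_uncurry).sub ((hw i hi).comp continuous_snd)
    exact (hc.tendsto (a, x)).eventually (lt_mem_nhds (hpos i hi x hx.1 hx.2))
  filter_upwards [(Filter.eventually_all_finite (finite_Iic m)).mpr h] with a' ha' i hi x hx hxb
  exact (ha' i hi x ⟨hx, hxb⟩).le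

/-- Reflection shifts `x` along `ν` by twice its distance to the plane, at most `2 * δ` since
heights are nonnegative. -/
theorem IsSmoothStrictlyConvexDomain.hyperplaneReflection_mem
    (hΩ : IsSmoothStrictlyConvexDomain Ω) (hx₀ : x₀ ∈ frontier Ω)
    (hν : IsInwardUnitNormal Ω x₀ ν) {δ : ℝ}
    (hδ : ∀ x ∈ closure Ω, inner ℝ (x - x₀) ν ≤ δ → ∀ h : ℝ, 0 < h → h ≤ 2 * δ → x + h • ν ∈ Ω)
    {a : ℝ} (ha : a ≤ δ) {x : En n} (hx : x ∈ closure Ω) (hxa : inner ℝ (x - x₀) ν < a) :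
    hyperplaneReflection x₀ ν a x ∈ Ω :=
  hδ x hx (by linarith) _ (by linarith) (by linarith [hΩ.inner_nonneg hx₀ hν hx])

/-- Monotonicity of two coupled chains in the caps whose reflections stay in the domain. -/
theorem IsSmoothStrictlyConvexDomain.reflection_sub_pos (hΩ : IsSmoothStrictlyConvexDomain Ω)
    (hn : n ≠ 0) (hx₀ : x₀ ∈ frontier Ω) (hν : IsInwardUnitNormal Ω x₀ ν) {δ : ℝ} (hδ0 : 0 < δ)
    (hδ : ∀ x ∈ closure Ω, inner ℝ (x - x₀) ν ≤ δ → ∀ h : ℝ, 0 < h → h ≤ 2 * δ → x + h • ν ∈ Ω)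
    {m m' : ℕ} {σ σ' p q : ℝ} (hσ : σ ∈ Ioo (0 : ℝ) 1) (hσ' : σ' ∈ Ioo (0 : ℝ) 1) (hp : 1 ≤ p)
    (hq : 1 ≤ q) {w z : ℕ → En n → ℝ} (hw : IsNavierChain Ω m σ w fun x => z 0 x ^ p)
    (hz : IsNavierChain Ω m' σ' z fun x => w 0 x ^ q)
    (hw0 : ∀ x ∈ Ω, 0 < w 0 x) (hz0 : ∀ x ∈ Ω, 0 < z 0 x) {a : ℝ} (ha0 : 0 < a) (ha : a ≤ δ) :
    (∀ i ≤ m, ∀ x ∈ closure Ω, inner ℝ (x - x₀) ν < a →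
      0 < w i (hyperplaneReflection x₀ ν a x) - w i x) ∧
    (∀ i ≤ m', ∀ x ∈ closure Ω, inner ℝ (x - x₀) ν < a →
      0 < z i (hyperplaneReflection x₀ ν a x) - z i x) := by
  have hK := hΩ.isCompact_closure
  have hν1 := hν.norm_eq_one
  have hwpos : ∀ i ≤ m, ∀ x ∈ Ω, 0 < w i x := fun i hi =>
    hw.pos hK hσ (fun x hx => Real.rpow_pos_of_pos (hz0 x hx) p) hi
  have hzpos : ∀ i ≤ m', ∀ x ∈ Ω, 0 < z i x := fun i hi =>
    hz.pos hK hσ' (fun x hx => Real.rpow_pos_of_pos (hw0 x hx) q) hi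
  have hcap : ∀ a ≤ δ, ∀ x ∈ closure Ω, inner ℝ (x - x₀) ν < a →
      hyperplaneReflection x₀ ν a x ∈ Ω := fun a ha x hx hxa =>
    hΩ.hyperplaneReflection_mem hx₀ hν hδ ha hx hxa
  have hwnn : ∀ x, 0 ≤ w 0 x := hw.nonneg hwpos (Nat.zero_le _)
  have hznn : ∀ x, 0 ≤ z 0 x := hz.nonneg hzpos (Nat.zero_le _)
  have hstrict : ∀ a, 0 < a → a ≤ δ → CapNonneg Ω x₀ ν m w a → CapNonneg Ω x₀ ν m' z a →
      (∀ i ≤ m, ∀ x ∈ closure Ω, inner ℝ (x - x₀) ν < a →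
        0 < w i (hyperplaneReflection x₀ ν a x) - w i x) ∧
      (∀ i ≤ m', ∀ x ∈ closure Ω, inner ℝ (x - x₀) ν < a →
        0 < z i (hyperplaneReflection x₀ ν a x) - z i x) := by
    intro a ha0 ha h1 h2
    refine ⟨fun i hi => hw.reflection_sub_pos hK hΩ.isOpen hn hσ hν1 hwpos hx₀ ha0 (hcap a ha) h1
      (fun x hx hxa => ?_) hi, fun i hi => hz.reflection_sub_pos hK hΩ.isOpen hn hσ' hν1 hzpos hx₀
      ha0 (hcap a ha) h2 (fun x hx hxa => ?_) hi⟩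
    · exact Real.rpow_le_rpow (hznn x)
        (sub_nonneg.mp (h2 0 (Nat.zero_le _) x (subset_closure hx) hxa.le)) (by linarith)
    · exact Real.rpow_le_rpow (hwnn x)
        (sub_nonneg.mp (h1 0 (Nat.zero_le _) x (subset_closure hx) hxa.le)) (by linarith)
  -- The width `l` may depend on the solution but not on `a`.
  obtain ⟨l, hl, hnarrow⟩ : ∃ l : ℝ, 0 < l ∧ ∀ a ≤ δ,
      (∀ i ≤ m, ∀ x ∈ closure Ω, inner ℝ (x - x₀) ν ≤ a - l →
        0 ≤ w i (hyperplaneReflection x₀ ν a x) - w i x) →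
      (∀ i ≤ m', ∀ x ∈ closure Ω, inner ℝ (x - x₀) ν ≤ a - l →
        0 ≤ z i (hyperplaneReflection x₀ ν a x) - z i x) →
      CapNonneg Ω x₀ ν m w a ∧ CapNonneg Ω x₀ ν m' z a := by
    obtain ⟨Bw, hBw0, hBw⟩ := hw.exists_bound hK (Nat.zero_le m)
    obtain ⟨Bz, hBz0, hBz⟩ := hz.exists_bound hK (Nat.zero_le m')
    obtain ⟨C, hC0, hC⟩ := exists_rpow_sub_rpow_ge hp hBz0
    obtain ⟨C', hC0', hC'⟩ := exists_rpow_sub_rpow_ge hq hBw0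
    obtain ⟨l, ⟨h1, h2⟩, hl0, hl1⟩ := (((eventually_le_narrow_constant (n := n) hσ
      (2 * C + 1)).and (eventually_le_narrow_constant (n := n) hσ' (2 * C' + 1))).and
      (Ioo_mem_nhdsGT (zero_lt_one : (0 : ℝ) < 1))).exists
    refine ⟨l, hl0, fun a ha hwfar hzfar => ?_⟩
    have hwz : ∀ M, 0 ≤ M → (∀ x ∈ closure Ω, inner ℝ (x - x₀) ν ≤ a →
        -M ≤ z m' (hyperplaneReflection x₀ ν a x) - z m' x) → ∀ x ∈ closure Ω,
        inner ℝ (x - x₀) ν ≤ a → -(M / 2) ≤ w m (hyperplaneReflection x₀ ν a x) - w m x :=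
      fun M hM hzM => hw.reflection_sub_ge_half hz hK hΩ.isOpen hn hσ hν1 hwpos hzpos hBz hC0 hC
        (hcap a ha) hl0 hl1.le h1 hwfar hzfar hM hzM
    have hzw : ∀ M, 0 ≤ M → (∀ x ∈ closure Ω, inner ℝ (x - x₀) ν ≤ a →
        -M ≤ w m (hyperplaneReflection x₀ ν a x) - w m x) → ∀ x ∈ closure Ω,
        inner ℝ (x - x₀) ν ≤ a → -(M / 2) ≤ z m' (hyperplaneReflection x₀ ν a x) - z m' x :=
      fun M hM hwM => hz.reflection_sub_ge_half hw hK hΩ.isOpen hn hσ' hν1 hzpos hwpos hBw hC0' hC'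
        (hcap a ha) hl0 hl1.le h2 hzfar hwfar hM hwM
    have hzlast : ∀ x ∈ closure Ω, inner ℝ (x - x₀) ν ≤ a →
        0 ≤ z m' (hyperplaneReflection x₀ ν a x) - z m' x := by
      intro x hx hxa
      obtain ⟨y, hy, hymin⟩ := (IsNavierChain.isCompact_cap (x₀ := x₀) (ν := ν) (a := a)
        hK).exists_isMinOn ⟨x, hx, hxa⟩
        (hz.continuous_reflection_sub (x₀ := x₀) (ν := ν) (a := a) le_rfl).continuousOn
      refine le_trans ?_ (hymin ⟨hx, hxa⟩)
      by_contra! hneg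
      set V := z m' (hyperplaneReflection x₀ ν a y) - z m' y with hV
      -- Starting from the minimum `V < 0`, one trip around the system improves the bound to `V /
      -- 4`. Evaluated at the minimizer this gives `V / 4 ≤ V`, a contradiction.
      have hb := hwz (-V) (by linarith) fun x hx hxa => by
        rw [neg_neg]
        exact hymin ⟨hx, hxa⟩
      have := hzw (-V / 2) (by linarith) hb y hy.1 hy.2
      rw [← hV] at this
      linarith
    have hwlast := hwz 0 le_rfl fun x hx hxa => by simpa using hzlast x hx hxa
    refine ⟨fun i hi x hx hxa => ?_, fun i hi x hx hxa => ?_⟩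
    · simpa using hw.reflection_sub_ge hK hΩ.isOpen hν1 hwpos (hcap a ha) hl1.le hwfar le_rfl
        (fun x hx hxa => by simpa using hwlast x hx hxa) hi x hx hxa
    · simpa using hz.reflection_sub_ge hK hΩ.isOpen hν1 hzpos (hcap a ha) hl1.le hzfar le_rfl
        (fun x hx hxa => by simpa using hzlast x hx hxa) hi x hx hxa
  have hall : Icc 0 δ ⊆ {a : ℝ | CapNonneg Ω x₀ ν m w a} ∩ {a : ℝ | CapNonneg Ω x₀ ν m' z a} := by
    have hclosed : IsClosed ({a : ℝ | CapNonneg Ω x₀ ν m w a} ∩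
        {a : ℝ | CapNonneg Ω x₀ ν m' z a}) :=
      (isClosed_capNonneg hw.continuous).inter (isClosed_capNonneg hz.continuous)
    refine (hclosed.inter isClosed_Icc).Icc_subset_of_forall_mem_nhdsWithin ?_ ?_
    -- At height zero the region below `-l` contains no point of the closure, so the narrow region
    -- principle applies vacuously.
    · refine hnarrow 0 hδ0.le (fun i _ x hx hx0 => ?_) (fun i _ x hx hx0 => ?_) <;>
      · have := hΩ.inner_nonneg hx₀ hν hx
        linarith
    · rintro a ⟨⟨hwa, hza⟩, ha0, haδ⟩
      -- Half of the width is held in reserve: strict positivity up to `a - l / 2` survives small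
      -- moves of the plane, and `a' - l ≤ a - l / 2` whenever `a' ≤ a + l / 2`.
      have hfar : (∀ i ≤ m, ∀ x ∈ closure Ω, inner ℝ (x - x₀) ν ≤ a - l / 2 →
            0 < w i (hyperplaneReflection x₀ ν a x) - w i x) ∧
          (∀ i ≤ m', ∀ x ∈ closure Ω, inner ℝ (x - x₀) ν ≤ a - l / 2 →
            0 < z i (hyperplaneReflection x₀ ν a x) - z i x) := by
        rcases ha0.eq_or_lt with rfl | ha0
        · constructor <;> intro i _ x hx hxl <;>
          · have := hΩ.inner_nonneg hx₀ hν hx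
            linarith
        · obtain ⟨h1, h2⟩ := hstrict a ha0 haδ.le hwa hza
          exact ⟨fun i hi x hx hxl => h1 i hi x hx (by linarith),
            fun i hi x hx hxl => h2 i hi x hx (by linarith)⟩
      have hev := ((eventually_reflection_sub_nonneg hK hw.continuous hfar.1).and
        (eventually_reflection_sub_nonneg hK hz.continuous hfar.2)).filter_mono
          (nhdsWithin_le_nhds (s := Ioi a))
      filter_upwards [hev, Ioo_mem_nhdsGT (lt_min haδ (by linarith : a < a + l / 2))]
        with a' h1 ⟨_, h3⟩
      have h4 : a' ≤ a + l / 2 := h3.le.trans (min_le_right _ _)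
      exact hnarrow a' (h3.le.trans (min_le_left _ _))
        (fun i hi x hx hxl => h1.1 i hi x hx (by linarith))
        (fun i hi x hx hxl => h1.2 i hi x hx (by linarith))
  obtain ⟨h1, h2⟩ := hall ⟨ha0.le, ha⟩
  exact hstrict a ha0 ha h1 h2

theorem strictlyIncreasingAlong_boundaryLayer (hν : ‖ν‖ = 1) {δ : ℝ} {f : En n → ℝ}
    (hf : ∀ a, 0 < a → a ≤ δ → ∀ x ∈ closure Ω, inner ℝ (x - x₀) ν < a →
      0 < f (hyperplaneReflection x₀ ν a x) - f x) :
    StrictlyIncreasingAlong ν (boundaryLayer Ω x₀ ν δ) f := by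
  rintro x ⟨hx, hx0, _⟩ h hh ⟨_, _, hxh⟩
  have h1 : inner ℝ (x + h • ν - x₀) ν = inner ℝ (x - x₀) ν + h := by
    rw [add_sub_right_comm, inner_add_left, real_inner_smul_left, real_inner_self_eq_norm_sq, hν]
    ring
  rw [h1] at hxh
  -- The plane halfway between the two points interchanges them; its height is positive and stays
  -- below `δ` because the upper point is in the layer.
  have h2 := hf (inner ℝ (x - x₀) ν + h / 2) (by linarith) (by linarith) x hx (by linarith)
  have h3 : hyperplaneReflection x₀ ν (inner ℝ (x - x₀) ν + h / 2) x = x + h • ν := by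
    rw [hyperplaneReflection]
    congr 2
    ring
  rw [h3] at h2
  linarith

end MovingPlanes

theorem lemma2p1 (n : ℕ) (hn : 1 ≤ n) (Ω : Set (En n)) (hΩ : IsSmoothStrictlyConvexDomain Ω)
    (x₀ : En n) (hx₀ : x₀ ∈ frontier Ω) (ν₀ : En n) (hν₀ : IsInwardUnitNormal Ω x₀ ν₀) :
    ∃ δ₀ : ℝ, 0 < δ₀ ∧
      ∀ (s₀ t₀ : ℕ) (s₁ t₁ p q : ℝ), 1 ≤ s₀ → 1 ≤ t₀ →
        s₁ ∈ Set.Ioo (0 : ℝ) 1 → t₁ ∈ Set.Ioo (0 : ℝ) 1 → 1 ≤ p → 1 ≤ q →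
        ∀ u v : En n → ℝ, IsPositiveSolution Ω s₀ t₀ s₁ t₁ p q u v →
          (∀ i ≤ s₀, StrictlyIncreasingAlong ν₀ (boundaryLayer Ω x₀ ν₀ δ₀)
            (iterNegLaplacian Ω i u)) ∧
          (∀ j ≤ t₀, StrictlyIncreasingAlong ν₀ (boundaryLayer Ω x₀ ν₀ δ₀)
            (iterNegLaplacian Ω j v)) := by
  obtain ⟨δ, hδ0, hδ⟩ := hΩ.exists_cap_translate_mem hx₀ hν₀
  refine ⟨δ, hδ0, fun s₀ t₀ s₁ t₁ p q _ _ hs₁ ht₁ hp hq u v h => ?_⟩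
  have hw : IsNavierChain Ω s₀ s₁ (fun i => iterNegLaplacian Ω i u)
      (fun x => iterNegLaplacian Ω 0 v x ^ p) :=
    hΩ.isNavierChain h.admissible_u.2 h.navier_u (by simpa [iterNegLaplacian_zero] using h.eq_u)
  have hz : IsNavierChain Ω t₀ t₁ (fun i => iterNegLaplacian Ω i v)
      (fun x => iterNegLaplacian Ω 0 u x ^ q) :=
    hΩ.isNavierChain h.admissible_v.2 h.navier_v (by simpa [iterNegLaplacian_zero] using h.eq_v)
  have hmain := fun a (ha0 : 0 < a) (ha : a ≤ δ) =>
    hΩ.reflection_sub_pos (w := fun i => iterNegLaplacian Ω i u)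
      (z := fun i => iterNegLaplacian Ω i v) (by omega) hx₀ hν₀ hδ0 hδ hs₁ ht₁ hp hq hw hz
      (by simpa [iterNegLaplacian_zero] using h.pos_u)
      (by simpa [iterNegLaplacian_zero] using h.pos_v) ha0 ha
  exact ⟨fun i hi => strictlyIncreasingAlong_boundaryLayer hν₀.norm_eq_one
      fun a ha0 ha => (hmain a ha0 ha).1 i hi,
    fun i hi => strictlyIncreasingAlong_boundaryLayer hν₀.norm_eq_one
      fun a ha0 ha => (hmain a ha0 ha).2 i hi⟩
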